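/- Let $K=\mathbb R^2/\Gamma$ be the Klein bottle, where $\mathbb R^2=\mathbb C$ and $\Gamma$ is generated by the glide reflection $\sigma:z\mapsto\bar z+\pi$ and the vertical translation $t:z\mapsto z+2i$. (Replacing $2i$ by $2i\beta$, $\beta>0$, gives a diffeomorphic manifold.) For a Riemannian metric $g$ on $K$, let $l_v(g)$ be the least length (infimum) of a closed curve freely homotopic to the loop closed by $t$, and let $L_\sigma(g)$ be the least length of a closed curve freely homotopic to a loop closed by a nontrivial element of the subgroup $\langle\sigma\rangle$; let $L_{t\sigma}(g)$ be defined in the same way from the other glide reflection $t\sigma$. Metrics are only required to be continuous; in particular all smooth metrics are allowed. 1. For every Riemannian metric $g$ on $K$, $L_\sigma(g)\,l_v(g)\le 2\,\mathrm{vol}(g)$. 2. The constant $2$ is optimal: for every real $C<2$ there is a smooth Riemannian metric $g$ on $K$ with $L_\sigma(g)\,l_v(g)>C\,\mathrm{vol}(g)$, and one can also have $L_{t\sigma}(g)\,l_v(g)>C\,\mathrm{vol}(g)$ for the same $g$. 3. Equality is never attained: $L_\sigma(g)\,l_v(g)\ne 2\,\mathrm{vol}(g)$ for every Riemannian metric $g$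 on $K$. 4. The number $2$ is the supremum over $\beta>0$ of the constants $$C_\beta=\frac{\arcsin\left(\frac{e^\beta-1}{e^\beta+1}\right)}{\frac{e^\beta-1}{e^\beta+1}}\quad\text{if } 0<\beta\le 2\ln(2+\sqrt3),\qquad C_\beta=\frac23\cdot\frac{3\beta+4\pi-6\ln(2+\sqrt3)}{4\sqrt3+\beta-2\ln(2+\sqrt3)}\quad\text{if }\beta>2\ln(2+\sqrt3).$$ -/

import Mathlib

open scoped ContDiff

noncomputable section

/-- The glide reflection `σ : z ↦ conj z + π` of the plane `ℝ² = ℂ`. -/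
def glide : Equiv.Perm ℂ where
  toFun z := (starRingEnd ℂ) z + (Real.pi : ℂ)
  invFun z := (starRingEnd ℂ) z - (Real.pi : ℂ)
  left_inv z := by simp
  right_inv z := by simp

/-- The vertical translation `t : z ↦ z + 2 i`.
(The quotients of the plane by `σ` and `z ↦ z + 2 i β`, for the various `β > 0`, are all
diffeomorphic, through `x + i y ↦ x + i β y`, which commutes with `σ` and carries one translation
to the other. The manifold is the one with `β = 1`, and carries arbitrary metrics below.) -/
def vert : Equiv.Perm ℂ where
  toFun z := z + 2 * Complex.I
  invFun z := z - 2 * Complex.I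
  left_inv z := by simp
  right_inv z := by simp

/-- The group `Γ` generated by `σ` and `t`. -/
def kleinGroup : Subgroup (Equiv.Perm ℂ) := Subgroup.closure {glide, vert}

/-- The Klein bottle `K = ℝ² / Γ`, with the quotient topology. -/
abbrev KleinBottle : Type := Quotient (MulAction.orbitRel kleinGroup ℂ)

/-- The universal covering map `ℝ² → K`. -/
def kleinProj : C(ℂ, KleinBottle) where
  toFun z := Quotient.mk _ z
  continuous_toFun := continuous_quotient_mk'

/-- The curve in `K`, parametrized by `[0, 1]`, with lift `c`. -/
def projCurve (c : C(ℝ, ℂ)) : C(unitInterval, KleinBottle) :=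
  kleinProj.comp (c.comp ⟨Subtype.val, continuous_subtype_val⟩)

/-- The loop in `K` closed by the deck transformation `γ`: the image of the segment
from `0` to `γ 0`. -/
def loopClosedBy (γ : Equiv.Perm ℂ) : C(unitInterval, KleinBottle) :=
  projCurve ⟨fun s => (s : ℂ) * γ 0, by fun_prop⟩

/-- Free homotopy of closed curves: a homotopy through closed curves, without base point. -/
def FreelyHomotopic (c d : C(unitInterval, KleinBottle)) : Prop :=
  ContinuousMap.HomotopicWith c d (fun f => f 0 = f 1)

/-- The lifts of the `C¹` closed curves in `K` that are freely homotopic to the loop closed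
by `γ`. The velocity may vanish, so that every piecewise `C¹` curve has a `C¹`
parametrization. -/
def freeHomotopyClass (γ : Equiv.Perm ℂ) : Set C(ℝ, ℂ) :=
  {c | ContDiff ℝ 1 c ∧ FreelyHomotopic (projCurve c) (loopClosedBy γ)}

/-- A (continuous) Riemannian metric on `K`, given by its pullback to the universal cover,
that is, a Riemannian metric on the plane that is invariant under `Γ`. -/
structure KleinMetric where
  /-- the inner product at each point of the plane -/
  form : ℂ → ℂ →L[ℝ] ℂ →L[ℝ] ℝ
  continuous_form : Continuous form
  symm : ∀ z v w, form z v w = form z w v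
  pos : ∀ z v, v ≠ 0 → 0 < form z v v
  invariant : ∀ γ ∈ kleinGroup, ∀ z v w,
    form (γ z) (fderiv ℝ γ z v) (fderiv ℝ γ z w) = form z v w

namespace KleinMetric

/-- Smooth Riemannian metrics. -/
def IsSmooth (g : KleinMetric) : Prop := ContDiff ℝ ∞ g.form

/-- The length, for `g`, of the curve in `K` with lift `c`. -/
def length (g : KleinMetric) (c : C(ℝ, ℂ)) : ℝ :=
  ∫ s in (0 : ℝ)..1, √(g.form (c s) (deriv c s) (deriv c s))

/-- The volume of `(K, g)`: the integral of the Riemannian area density over the fundamental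
domain `[0, π) × [0, 2)` of `Γ`. -/
def vol (g : KleinMetric) : ℝ :=
  ∫ z in Set.Ico 0 Real.pi ×ℂ Set.Ico 0 2,
    √(g.form z 1 1 * g.form z Complex.I Complex.I - g.form z 1 Complex.I ^ 2)

/-- The least length of a closed curve freely homotopic to the loop closed by `γ`. -/
def leastLength (g : KleinMetric) (γ : Equiv.Perm ℂ) : ℝ :=
  sInf (g.length '' freeHomotopyClass γ)

/-- The least length of a closed curve freely homotopic to a loop closed by a nontrivial
element of the subgroup generated by `γ`. -/
def leastLengthPowers (g : KleinMetric) (γ : Equiv.Perm ℂ) : ℝ :=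
  sInf (g.length '' {c | ∃ δ ∈ Subgroup.zpowers γ, δ ≠ 1 ∧ c ∈ freeHomotopyClass δ})

/-- `L_σ(g)`. -/
def Lσ (g : KleinMetric) : ℝ := g.leastLengthPowers glide

/-- `l_v(g)`. -/
def lv (g : KleinMetric) : ℝ := g.leastLength vert

end KleinMetric

/-- The constant `C_β` of the inequality `L_σ l_v ≤ C_β vol` for metrics of conformal type
`β > 0`. -/
def conformalConstant (β : ℝ) : ℝ :=
  if β ≤ 2 * Real.log (2 + √3) then
    Real.arcsin ((Real.exp β - 1) / (Real.exp β + 1)) / ((Real.exp β - 1) / (Real.exp β + 1))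
  else
    2 / 3 * ((3 * β + 4 * Real.pi - 6 * Real.log (2 + √3)) /
      (4 * √3 + β - 2 * Real.log (2 + √3)))

end

/-! The bound is a calibration argument on the plane. Write d for `rdist`, the distance of the
lifted metric, L for `Lσ` and l for `lv`. A planar path has a chord equal to half of its
displacement (`exists_chord_eq_half`), so a lower bound for all d(z, z + τ) at least doubles when τ
is doubled; by subadditivity d(z, z + nτ) ≥ n m whenever m bounds every d(z, z + τ). This applies to
τ = 2π with m = L, since σ² is that translation, and to τ = 2i with m = l. Since σ acts on the
lattice by a reflection, both |a| L and |b| l bound d(z, z + 2πa + 2bi) from below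
(`abs_mul_Lσ_le_rdist`, `abs_mul_lv_le_rdist`). Hence there are 1-Lipschitz functions f and h with
periods (L, 0) and (0, l). Smoothing costs a factor θ < 1 in the periods; then df ∧ dh is at most
the area density, and integration over the torus that double covers K gives θ² L l ≤ 2 vol.

If L l = 2 vol, then (f, h) almost preserves area as θ → 1. Averaging over σ makes f ∘ σ = f + θL/2
and h ∘ σ = -h. At a point x with h(x) = 0 the images of x and σx are only θL/2 apart, although d(x,
σx) ≥ L. To turn this into a contradiction without any limit map, `transport_inequality` compares
the means of a truncated distance u from x over two squares of side about 2ρ around these images, by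
integrating du along the horizontal segments that join them. Discs of area about πρ² around x and
σx, mapped into the squares of area about 4ρ², control u; elsewhere only 0 ≤ u ≤ K with K near L is
used. To leading order this reads 2πLρ² ≤ 6Lρ², which is false because π > 3 (`not_calibrated`).

The constant is sharp for a(y)² dx² + B² dy² with a = 2 at integer heights and a close to 1
elsewhere: glide axes lie at integer heights, and a large B makes it expensive to leave their
neighbourhoods. The constants C_β stay below 2 and tend to 2 as β → ∞. -/

noncomputable section

/-! ### Half chords of planar paths, and the constants C_β. -/

/-- A planar path has a chord equal to half of its total displacement. -/
theorem exists_chord_eq_half {c : ℝ → ℂ} (hc : Continuous c) {v : ℂ} (hv : c 1 = c 0 + 2 * v) :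
    ∃ s s' : ℝ, 0 ≤ s ∧ s ≤ s' ∧ s' ≤ 1 ∧ c s' = c s + v := by
  by_cases hv0 : v = 0
  · exact ⟨0, 0, le_rfl, le_rfl, zero_le_one, by simp [hv0]⟩
  by_contra! hne
  -- Clamping to [0, 1] and ordering by `max` and `min` extends chord minus v to the whole plane,
  -- which is simply connected, so that a continuous logarithm exists there.
  set p : ℝ → ℝ := fun s => max 0 (min 1 s) with hp
  have hpc : Continuous p := by fun_prop
  let G : C(ℝ × ℝ, ℂ) := ⟨fun x => c (max (p x.1) (p x.2)) - c (min (p x.1) (p x.2)) - v, by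
    fun_prop⟩
  have hp0 (s) : 0 ≤ p s := le_max_left _ _
  have hp1 (s) : p s ≤ 1 := max_le zero_le_one (min_le_left _ _)
  have hps {s} (h0 : 0 ≤ s) (h1 : s ≤ 1) : p s = s := by
    simp [hp, min_eq_right h1, max_eq_right h0]
  have hG (x) : G x ∈ ({0}ᶜ : Set ℂ) := by
    simp only [Set.mem_compl_iff, Set.mem_singleton_iff]
    intro h
    refine hne (min (p x.1) (p x.2)) (max (p x.1) (p x.2)) (le_min (hp0 _) (hp0 _)) min_le_max
      (max_le (hp1 _) (hp1 _)) ?_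
    have : c (max (p x.1) (p x.2)) - c (min (p x.1) (p x.2)) - v = 0 := h
    linear_combination this
  obtain ⟨θ, ⟨-, hθ⟩, -⟩ := Complex.isCoveringMapOn_exp.existsUnique_continuousMap_lifts G
    (a₀ := 0) (e₀ := Complex.log (G 0)) (Complex.exp_log (hG 0)) hG
  have hexp (x) : Complex.exp (θ x) = G x := congr_fun hθ x
  -- The chords from c 0 to c τ and from c τ to c 1 add up to 2v. So the logarithm changes by the
  -- same amount along two sides of the triangle, while it is constant along the diagonal, where `G`
  -- is -v. Both changes thus vanish, against `G (0, 1) = -G (0, 0)`.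
  have key (τ : ℝ) (h0 : 0 ≤ τ) (h1 : τ ≤ 1) : G (τ, 1) = - G (0, τ) := by
    simp only [G, ContinuousMap.coe_mk]
    rw [hps h0 h1, hps zero_le_one le_rfl, hps le_rfl zero_le_one, max_eq_right h1, min_eq_left h1,
      max_eq_right h0, min_eq_left h0, hv]
    ring
  -- a continuous logarithm of a constant is constant
  have aux {q : ℝ → ℂ} (hq : Continuous q) {w : ℂ}
      (h : ∀ τ ∈ Set.Icc (0 : ℝ) 1, Complex.exp (q τ) = w) : q 0 = q 1 := by
    refine (Complex.isCoveringMap_exp.eqOn_of_comp_eqOn (s := Set.Icc (0 : ℝ) 1)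
      isPreconnected_Icc hq.continuousOn (continuousOn_const (c := q 0))
      (fun τ hτ => ?_) (by simp : (0 : ℝ) ∈ _) rfl (by simp : (1 : ℝ) ∈ _)).symm
    ext
    simp [h τ hτ, h 0 (by simp)]
  have hd : θ (0, 0) = θ (1, 1) := by
    refine aux (q := fun τ => θ (τ, τ)) (by fun_prop) (w := -v) fun τ _ => ?_
    simp [hexp, G]
  have hs : θ (0, 1) - θ (0, 0) = θ (1, 1) - θ (0, 1) := by
    refine aux (q := fun τ => θ (τ, 1) - θ (0, τ)) (by fun_prop) (w := -1) fun τ hτ => ?_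
    rw [Complex.exp_sub, hexp, hexp, key τ hτ.1 hτ.2, neg_div, div_self (hG _)]
  have h1 : θ (0, 1) = θ (0, 0) := by
    rw [← hd] at hs
    linear_combination hs / 2
  have h2 := key 0 le_rfl zero_le_one
  rw [← hexp, ← hexp, h1] at h2
  exact Complex.exp_ne_zero (θ (0, 0)) (by linear_combination h2 / 2)

theorem conformalConstant_le_two {β : ℝ} (hβ : 0 < β) : conformalConstant β ≤ 2 := by
  unfold conformalConstant
  split_ifs with h
  · have h1 : 1 < Real.exp β := Real.one_lt_exp_iff.2 hβ
    set t := (Real.exp β - 1) / (Real.exp β + 1) with ht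
    have ht0 : 0 < t := div_pos (by linarith) (by linarith)
    have ht1 : t ≤ 1 := (div_le_one (by linarith)).2 (by linarith)
    rw [div_le_iff₀ ht0]
    have hs : 0 ≤ Real.arcsin t := Real.arcsin_nonneg.2 ht0.le
    -- Jordan's inequality gives arcsin t / t ≤ π/2 < 2.
    have := Real.mul_le_sin hs (Real.arcsin_le_pi_div_two t)
    rw [Real.sin_arcsin (by linarith) ht1, div_mul_eq_mul_div, div_le_iff₀ Real.pi_pos] at this
    nlinarith [Real.pi_lt_four]
  · have h3 : 0 < √3 := by positivity
    have h4 : 1.7 < √3 := Real.lt_sqrt_of_sq_lt (by norm_num)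
    push Not at h
    rw [← mul_div_assoc, div_le_iff₀ (by linarith)]
    linarith [Real.pi_lt_four]

theorem tendsto_conformalConstant :
    Filter.Tendsto conformalConstant Filter.atTop (nhds 2) := by
  set l := Real.log (2 + √3) with hl
  -- The second branch, after division with remainder in β.
  have h : Filter.Tendsto (fun β : ℝ => 2 + 2 / 3 * (4 * Real.pi - 12 * √3) / (4 * √3 + β - 2 * l))
      Filter.atTop (nhds (2 + 0)) := by
    refine tendsto_const_nhds.add (Filter.Tendsto.const_div_atTop ?_ _)
    simpa [add_sub_right_comm] using Filter.tendsto_atTop_add_const_left _ (4 * √3 - 2 * l)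
      Filter.tendsto_id
  rw [add_zero] at h
  refine h.congr' ?_
  filter_upwards [Filter.eventually_gt_atTop (2 * l)] with β hβ
  have h3 : 0 < √3 := by positivity
  have : 4 * √3 + β - 2 * l ≠ 0 := by linarith
  rw [conformalConstant, if_neg (not_le.2 hβ), ← hl]
  field_simp
  ring

theorem isLUB_conformalConstant : IsLUB (conformalConstant '' Set.Ioi 0) 2 := by
  refine ⟨?_, fun b hb => ?_⟩
  · rintro _ ⟨β, hβ, rfl⟩
    exact conformalConstant_le_two hβ
  · refine le_of_tendsto tendsto_conformalConstant ?_
    filter_upwards [Filter.eventually_gt_atTop 0] with β hβ using hb ⟨β, hβ, rfl⟩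

end

/-! ### The deck group, the covering, and free homotopy classes. -/

noncomputable section

open Complex in
theorem kleinGroup_normalForm {γ : Equiv.Perm ℂ} (hγ : γ ∈ kleinGroup) :
    ∃ p q : ℤ, (Even p ∧ ∀ z, γ z = z + p * Real.pi + 2 * q * I) ∨
      (Odd p ∧ ∀ z, γ z = (starRingEnd ℂ) z + p * Real.pi + 2 * q * I) := by
  induction hγ using Subgroup.closure_induction with
  | mem x hx =>
    rcases hx with rfl | rfl
    · exact ⟨1, 0, .inr ⟨odd_one, fun z => by simp [glide]⟩⟩
    · exact ⟨0, 1, .inl ⟨Even.zero, fun z => by simp [vert]⟩⟩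
  | one => exact ⟨0, 0, .inl ⟨Even.zero, fun z => by simp⟩⟩
  | mul x y _ _ hx hy =>
    obtain ⟨p, q, ⟨hp, hx⟩ | ⟨hp, hx⟩⟩ := hx <;> obtain ⟨r, s, ⟨hr, hy⟩ | ⟨hr, hy⟩⟩ := hy
    · exact ⟨p + r, q + s, .inl ⟨hp.add hr, fun z => by simp [hx, hy]; ring⟩⟩
    · exact ⟨p + r, q + s, .inr ⟨hp.add_odd hr, fun z => by simp [hx, hy]; ring⟩⟩
    · exact ⟨p + r, q - s, .inr ⟨hp.add_even hr, fun z => by simp [hx, hy, map_ofNat]; ring⟩⟩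
    · exact ⟨p + r, q - s, .inl ⟨hp.add_odd hr, fun z => by simp [hx, hy, map_ofNat]; ring⟩⟩
  | inv x _ hx =>
    obtain ⟨p, q, ⟨hp, hx⟩ | ⟨hp, hx⟩⟩ := hx
    · refine ⟨-p, -q, .inl ⟨hp.neg, fun z => ?_⟩⟩
      rw [Equiv.Perm.inv_def, Equiv.symm_apply_eq, hx]; push_cast; ring
    · refine ⟨-p, q, .inr ⟨hp.neg, fun z => ?_⟩⟩
      rw [Equiv.Perm.inv_def, Equiv.symm_apply_eq, hx]; simp [map_ofNat]; ring

theorem glide_mem_kleinGroup : glide ∈ kleinGroup := Subgroup.subset_closure (by simp)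

theorem vert_mem_kleinGroup : vert ∈ kleinGroup := Subgroup.subset_closure (by simp)

theorem continuous_of_mem_kleinGroup {γ : Equiv.Perm ℂ} (hγ : γ ∈ kleinGroup) :
    Continuous γ := by
  obtain ⟨p, q, ⟨-, h⟩ | ⟨-, h⟩⟩ := kleinGroup_normalForm hγ <;> rw [funext h]
  · fun_prop
  · exact ((Complex.continuous_conj.add continuous_const).add continuous_const)

theorem affine_of_mem_kleinGroup {γ : Equiv.Perm ℂ} (hγ : γ ∈ kleinGroup) (u : ℝ) (a b : ℂ) :
    γ ((1 - u) * a + u * b) = (1 - u) * γ a + u * γ b := by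
  obtain ⟨p, q, ⟨-, h⟩ | ⟨-, h⟩⟩ := kleinGroup_normalForm hγ <;> simp [h] <;> ring

/-- Nontrivial translations move points by at least 2 and glide reflections by at least π. Balls of
radius 1 are therefore disjoint from their other translates, which makes the projection a covering.
-/
theorem eq_one_of_norm_sub_lt {γ : Equiv.Perm ℂ} (hγ : γ ∈ kleinGroup) {z : ℂ}
    (h : ‖γ z - z‖ < 2) : γ = 1 := by
  obtain ⟨p, q, ⟨hp, hz⟩ | ⟨hp, hz⟩⟩ := kleinGroup_normalForm hγ
  · have h1 := (Complex.abs_re_le_norm _).trans_lt h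
    have h2 := (Complex.abs_im_le_norm _).trans_lt h
    simp only [hz, Complex.sub_re, Complex.add_re, Complex.sub_im, Complex.add_im,
      Complex.mul_re, Complex.mul_im, Complex.intCast_re, Complex.intCast_im, Complex.ofReal_re,
      Complex.ofReal_im, Complex.I_re, Complex.I_im, Complex.re_ofNat, Complex.im_ofNat] at h1 h2
    ring_nf at h1 h2
    rw [abs_mul, abs_of_pos Real.pi_pos] at h1
    rw [abs_mul, abs_two] at h2
    have hp0 : p = 0 := by
      by_contra hne
      have : (1 : ℝ) ≤ |(p : ℝ)| := by exact_mod_cast Int.one_le_abs hne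
      nlinarith [Real.pi_gt_three]
    have hq0 : q = 0 := by
      by_contra hne
      have : (1 : ℝ) ≤ |(q : ℝ)| := by exact_mod_cast Int.one_le_abs hne
      nlinarith
    ext w
    simp [hz, hp0, hq0]
  · have h1 := (Complex.abs_re_le_norm _).trans_lt h
    simp only [hz, Complex.sub_re, Complex.add_re,
      Complex.mul_re, Complex.mul_im, Complex.intCast_re, Complex.intCast_im, Complex.ofReal_re,
      Complex.ofReal_im, Complex.I_re, Complex.I_im, Complex.re_ofNat, Complex.im_ofNat,
      Complex.conj_re] at h1
    ring_nf at h1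
    rw [abs_mul, abs_of_pos Real.pi_pos] at h1
    have hne : p ≠ 0 := by rintro rfl; simp at hp
    have : (1 : ℝ) ≤ |(p : ℝ)| := by exact_mod_cast Int.one_le_abs hne
    nlinarith [Real.pi_gt_three]

theorem kleinProj_eq_iff {z w : ℂ} : kleinProj z = kleinProj w ↔ ∃ γ ∈ kleinGroup, γ w = z := by
  rw [kleinProj, ContinuousMap.coe_mk, Quotient.eq, MulAction.orbitRel_apply,
    MulAction.mem_orbit_iff]
  exact ⟨fun ⟨γ, h⟩ => ⟨γ, γ.2, h⟩, fun ⟨γ, hγ, h⟩ => ⟨⟨γ, hγ⟩, h⟩⟩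

theorem isCoveringMap_kleinProj : IsCoveringMap kleinProj := by
  suffices IsQuotientCoveringMap kleinProj kleinGroup from this.isCoveringMap
  refine
    { toIsQuotientMap := isQuotientMap_quotient_mk'
      continuous_const_smul := fun γ => continuous_of_mem_kleinGroup γ.2
      apply_eq_iff_mem_orbit := fun {e₁ e₂} => ?_
      disjoint := fun e => ⟨Metric.ball e 1, Metric.ball_mem_nhds e one_pos, ?_⟩ }
  · rw [kleinProj_eq_iff, MulAction.mem_orbit_iff]
    exact ⟨fun ⟨γ, hγ, h⟩ => ⟨⟨γ, hγ⟩, h⟩, fun ⟨γ, h⟩ => ⟨γ, γ.2, h⟩⟩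
  · rintro ⟨γ, hγ⟩ ⟨_, ⟨z, hz, rfl⟩, hz'⟩
    refine Subtype.ext (eq_one_of_norm_sub_lt hγ (z := z) ?_)
    rw [← dist_eq_norm]
    have h1 : dist (γ z) e < 1 := hz'
    have h2 : dist z e < 1 := hz
    linarith [dist_triangle_right (γ z) z e]

theorem projCurve_apply (c : C(ℝ, ℂ)) (s : unitInterval) : projCurve c s = kleinProj (c s) := rfl

/-- Deck transformations are affine, so the straight-line homotopy to the model segment keeps the
endpoints related by γ and projects to closed curves. -/
theorem mem_freeHomotopyClass {γ : Equiv.Perm ℂ} (hγ : γ ∈ kleinGroup) {c : C(ℝ, ℂ)}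
    (hc : ContDiff ℝ 1 c) (h : c 1 = γ (c 0)) : c ∈ freeHomotopyClass γ := by
  refine ⟨hc, ⟨⟨⟨⟨fun x => kleinProj ((1 - ((x.1 : ℝ) : ℂ)) * c x.2 +
    ((x.1 : ℝ) : ℂ) * (((x.2 : ℝ) : ℂ) * γ 0)), by fun_prop⟩, fun s => ?_, fun s => ?_⟩, ?_⟩⟩⟩
  · simp [projCurve_apply]
  · simp [loopClosedBy, projCurve_apply]
  · intro u
    simp only [ContinuousMap.coe_mk, Set.Icc.coe_zero,
      Set.Icc.coe_one, Complex.ofReal_zero, Complex.ofReal_one, zero_mul, one_mul, h]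
    refine (kleinProj_eq_iff.2 ⟨γ, hγ, ?_⟩).symm
    exact affine_of_mem_kleinGroup hγ _ _ _

/-- Lift the free homotopy. The final curve is a translate by some δ of the model segment, so its
endpoints differ by δγδ⁻¹; uniqueness of lifts carries this relation back to the initial curve. -/
theorem exists_conj_of_mem_freeHomotopyClass {γ : Equiv.Perm ℂ} (hγ : γ ∈ kleinGroup)
    {c : C(ℝ, ℂ)} (hc : c ∈ freeHomotopyClass γ) :
    ∃ δ ∈ kleinGroup, c 1 = δ (γ (δ⁻¹ (c 0))) := by
  obtain ⟨-, ⟨H⟩⟩ := hc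
  have cov := isCoveringMap_kleinProj
  let c₀ : C(unitInterval, ℂ) := c.comp ⟨Subtype.val, continuous_subtype_val⟩
  have hH0 (s) : H (0, s) = kleinProj (c₀ s) := H.apply_zero s
  let K := cov.liftHomotopy H.toContinuousMap c₀ hH0
  have hK (x) : kleinProj (K x) = H x := congr_fun (cov.liftHomotopy_lifts _ c₀ hH0) x
  have hK0 (s : unitInterval) : K (0, s) = c s := cov.liftHomotopy_zero _ c₀ hH0 s
  have hK1 (s : unitInterval) : kleinProj (K (1, s)) = kleinProj ((s : ℝ) * γ 0) :=
    (hK _).trans (H.apply_one s)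
  obtain ⟨δ, hδ, hδ0⟩ := kleinProj_eq_iff.1 (hK1 0)
  have hend : K (1, 1) = δ (γ 0) := by
    have := congr_fun (cov.eq_of_comp_eq (g₁ := fun s : unitInterval => K (1, s))
      (g₂ := fun s : unitInterval => δ (((s : ℝ) : ℂ) * γ 0)) (by fun_prop)
      ((continuous_of_mem_kleinGroup hδ).comp (by fun_prop)) ?_ 0 hδ0.symm) 1
    · simpa using this
    · ext s
      exact (hK1 s).trans (kleinProj_eq_iff.2 ⟨δ, hδ, rfl⟩).symm
  have hδ' : δ * γ * δ⁻¹ ∈ kleinGroup := mul_mem (mul_mem hδ hγ) (inv_mem hδ)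
  have := congr_fun (cov.eq_of_comp_eq (g₁ := fun u : unitInterval => K (u, 1))
      (g₂ := fun u : unitInterval => (δ * γ * δ⁻¹) (K (u, 0))) (by fun_prop)
      ((continuous_of_mem_kleinGroup hδ').comp (by fun_prop)) ?_ 1 ?_) 0
  · refine ⟨δ, hδ, ?_⟩
    simpa [hK0] using this
  · ext u
    simp only [Function.comp_apply]
    rw [kleinProj_eq_iff.2 ⟨δ * γ * δ⁻¹, hδ', rfl⟩, hK, hK]
    exact (H.prop u).symm
  · simp [hend, ← hδ0]

end

/-! ### The Riemannian distance on the universal cover. -/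

noncomputable section

open ComplexConjugate

theorem hasFDerivAt_glide (z : ℂ) :
    HasFDerivAt glide (Complex.conjCLE : ℂ →L[ℝ] ℂ) z := by
  exact ((Complex.conjCLE : ℂ →L[ℝ] ℂ).hasFDerivAt (x := z)).add_const (Real.pi : ℂ)

theorem hasFDerivAt_vert (z : ℂ) : HasFDerivAt vert (ContinuousLinearMap.id ℝ ℂ) z :=
  (hasFDerivAt_id z).add_const (2 * Complex.I)

namespace KleinMetric

variable (g : KleinMetric)

theorem form_glide (z v w : ℂ) : g.form (conj z + Real.pi) (conj v) (conj w) = g.form z v w := by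
  have := g.invariant _ glide_mem_kleinGroup z v w
  rw [(hasFDerivAt_glide z).fderiv] at this
  exact this

theorem form_vert (z : ℂ) : g.form (z + 2 * Complex.I) = g.form z := by
  ext1 v
  ext1 w
  have := g.invariant _ vert_mem_kleinGroup z v w
  rw [(hasFDerivAt_vert z).fderiv] at this
  exact this

theorem form_add_two_pi (z : ℂ) : g.form (z + 2 * Real.pi) = g.form z := by
  ext1 v
  ext1 w
  rw [← g.form_glide z, ← g.form_glide _ (conj v)]
  simp only [map_add, Complex.conj_conj, Complex.conj_ofReal]
  congr 3
  ring

/-- The norm of the tangent vector `v` at `z`. -/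
def speed (z v : ℂ) : ℝ := √(g.form z v v)

theorem form_self_nonneg (z v : ℂ) : 0 ≤ g.form z v v := by
  rcases eq_or_ne v 0 with rfl | hv
  · simp
  · exact (g.pos z v hv).le

theorem sq_speed (z v : ℂ) : g.speed z v ^ 2 = g.form z v v := Real.sq_sqrt (g.form_self_nonneg z v)

theorem speed_nonneg (z v : ℂ) : 0 ≤ g.speed z v := Real.sqrt_nonneg _

theorem speed_pos (z : ℂ) {v : ℂ} (hv : v ≠ 0) : 0 < g.speed z v := Real.sqrt_pos.2 (g.pos z v hv)

theorem continuous_speed : Continuous fun x : ℂ × ℂ => g.speed x.1 x.2 := by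
  have := g.continuous_form
  unfold speed
  fun_prop

@[fun_prop]
theorem _root_.Continuous.kleinSpeed {X : Type*} [TopologicalSpace X] {a b : X → ℂ}
    (ha : Continuous a) (hb : Continuous b) : Continuous fun x => g.speed (a x) (b x) :=
  g.continuous_speed.comp (ha.prodMk hb)

theorem speed_smul (z v : ℂ) (r : ℝ) : g.speed z (r • v) = |r| * g.speed z v := by
  unfold speed
  rw [← Real.sqrt_sq_eq_abs, ← Real.sqrt_mul (sq_nonneg r)]
  simp only [map_smul, smul_apply, smul_eq_mul]
  ring_nf

theorem speed_neg (z v : ℂ) : g.speed z (-v) = g.speed z v := by simp [speed]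

theorem speed_glide (z v : ℂ) : g.speed (conj z + Real.pi) (conj v) = g.speed z v := by
  rw [speed, form_glide, speed]

/-- The length of an arc of a curve in the plane. -/
def arcLength (c : ℝ → ℂ) (a b : ℝ) : ℝ := ∫ s in a..b, g.speed (c s) (deriv c s)

theorem continuous_speed_deriv {c : ℝ → ℂ} (hc : ContDiff ℝ 1 c) :
    Continuous fun s => g.speed (c s) (deriv c s) :=
  hc.continuous.kleinSpeed g (hc.continuous_deriv le_rfl)

theorem arcLength_nonneg (c : ℝ → ℂ) {a b : ℝ} (hab : a ≤ b) : 0 ≤ g.arcLength c a b :=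
  intervalIntegral.integral_nonneg hab fun _ _ => g.speed_nonneg _ _

theorem arcLength_add {c : ℝ → ℂ} (hc : ContDiff ℝ 1 c) (a b d : ℝ) :
    g.arcLength c a b + g.arcLength c b d = g.arcLength c a d :=
  intervalIntegral.integral_add_adjacent_intervals
    ((g.continuous_speed_deriv hc).intervalIntegrable _ _)
    ((g.continuous_speed_deriv hc).intervalIntegrable _ _)

/-- A `C¹` curve that stays at `z` before time `0` and at `w` after time `1`. -/
structure _root_.IsRestPath (c : ℝ → ℂ) (z w : ℂ) : Prop where
  contDiff : ContDiff ℝ 1 c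
  left : ∀ s ≤ 0, c s = z
  right : ∀ s, 1 ≤ s → c s = w

/-- The Riemannian distance of the metric on the plane. -/
def rdist (z w : ℂ) : ℝ := sInf {ℓ | ∃ c, IsRestPath c z w ∧ g.arcLength c 0 1 = ℓ}

theorem arcLength_comp {c : ℝ → ℂ} (hc : ContDiff ℝ 1 c) {ψ : ℝ → ℝ} (hψ : ContDiff ℝ 1 ψ)
    (hm : Monotone ψ) (a b : ℝ) :
    g.arcLength (c ∘ ψ) a b = g.arcLength c (ψ a) (ψ b) := by
  unfold arcLength
  rw [← intervalIntegral.integral_comp_mul_deriv (f := ψ) (f' := deriv ψ)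
    (fun x _ => ((hψ.differentiable one_ne_zero) x).hasDerivAt)
    (hψ.continuous_deriv le_rfl).continuousOn (g.continuous_speed_deriv hc)]
  refine intervalIntegral.integral_congr fun s _ => ?_
  have : HasDerivAt (c ∘ ψ) (deriv ψ s • deriv c (ψ s)) s :=
    ((hc.differentiable one_ne_zero) (ψ s)).hasDerivAt.scomp s
      ((hψ.differentiable one_ne_zero) s).hasDerivAt
  simp only [Function.comp_apply]
  rw [this.deriv, speed_smul, abs_of_nonneg hm.deriv_nonneg, mul_comm]

theorem bddBelow_lengths (z w : ℂ) :
    BddBelow {ℓ | ∃ c, IsRestPath c z w ∧ g.arcLength c 0 1 = ℓ} :=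
  ⟨0, by rintro _ ⟨c, -, rfl⟩; exact g.arcLength_nonneg c zero_le_one⟩

/-- Reparametrization by a smooth step makes a path rest at both ends, so that paths can later be
joined without losing `C¹`. -/
theorem exists_isRestPath {c : ℝ → ℂ} (hc : ContDiff ℝ 1 c) {a b : ℝ} (hab : a ≤ b) :
    ∃ c', IsRestPath c' (c a) (c b) ∧ g.arcLength c' 0 1 = g.arcLength c a b := by
  let ψ : ℝ → ℝ := fun s => a + (b - a) * s.smoothTransition
  have hψ : ContDiff ℝ 1 ψ :=
    contDiff_const.add (contDiff_const.mul (Real.smoothTransition.contDiff (n := 1)))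
  have hm : Monotone ψ := fun x y h =>
    add_le_add_right (mul_le_mul_of_nonneg_left (Real.smoothTransition.monotone h)
      (sub_nonneg.2 hab)) a
  refine ⟨c ∘ ψ, ⟨hc.comp hψ, fun s hs => ?_, fun s hs => ?_⟩, ?_⟩
  · simp [ψ, Real.smoothTransition.zero_of_nonpos hs]
  · simp [ψ, Real.smoothTransition.one_of_one_le hs]
  · rw [g.arcLength_comp hc hψ hm]
    simp [ψ]

theorem lengths_nonempty (z w : ℂ) :
    {ℓ | ∃ c, IsRestPath c z w ∧ g.arcLength c 0 1 = ℓ}.Nonempty := by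
  have hc : ContDiff ℝ 1 fun s : ℝ => z + s * (w - z) := by
    have := Complex.ofRealCLM.contDiff (n := 1)
    exact contDiff_const.add (this.mul contDiff_const)
  obtain ⟨c', h, h'⟩ := g.exists_isRestPath hc zero_le_one
  exact ⟨_, c', by simpa using h, rfl⟩

theorem rdist_nonneg (z w : ℂ) : 0 ≤ g.rdist z w :=
  Real.sInf_nonneg (by rintro _ ⟨c, -, rfl⟩; exact g.arcLength_nonneg c zero_le_one)

theorem rdist_le_arcLength {c : ℝ → ℂ} (hc : ContDiff ℝ 1 c) {a b : ℝ} (hab : a ≤ b) :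
    g.rdist (c a) (c b) ≤ g.arcLength c a b :=
  csInf_le (g.bddBelow_lengths _ _) (g.exists_isRestPath hc hab)

theorem le_rdist {z w : ℂ} {m : ℝ} (h : ∀ c, IsRestPath c z w → m ≤ g.arcLength c 0 1) :
    m ≤ g.rdist z w :=
  le_csInf (g.lengths_nonempty z w) (by rintro _ ⟨c, hc, rfl⟩; exact h c hc)

theorem exists_isRestPath_lt {z w : ℂ} {r : ℝ} (h : g.rdist z w < r) :
    ∃ c, IsRestPath c z w ∧ g.arcLength c 0 1 < r := by
  obtain ⟨_, ⟨c, hc, rfl⟩, hr⟩ := exists_lt_of_csInf_lt (g.lengths_nonempty z w) h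
  exact ⟨c, hc, hr⟩

theorem rdist_self (z : ℂ) : g.rdist z z = 0 := by
  refine le_antisymm ?_ (g.rdist_nonneg z z)
  simpa [arcLength] using
    g.rdist_le_arcLength (c := fun _ => z) contDiff_const (le_refl (0 : ℝ))

theorem rdist_triangle (z x w : ℂ) : g.rdist z w ≤ g.rdist z x + g.rdist x w := by
  refine le_of_forall_pos_le_add fun ε hε => ?_
  obtain ⟨c₁, h₁, hl₁⟩ := g.exists_isRestPath_lt (lt_add_of_pos_right (g.rdist z x) (half_pos hε))
  obtain ⟨c₂, h₂, hl₂⟩ := g.exists_isRestPath_lt (lt_add_of_pos_right (g.rdist x w) (half_pos hε))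
  -- At every time at least one of the two paths rests at x, so this sum is their concatenation.
  let c : ℝ → ℂ := fun s => c₁ s + c₂ (s - 1) - x
  have hc : ContDiff ℝ 1 c :=
    (h₁.contDiff.add (h₂.contDiff.comp (contDiff_id.sub contDiff_const))).sub contDiff_const
  have e₁ : g.arcLength c 0 1 = g.arcLength c₁ 0 1 := by
    refine intervalIntegral.integral_congr_Ioo_of_le zero_le_one fun s hs => ?_
    have : c =ᶠ[nhds s] c₁ := by
      filter_upwards [Iio_mem_nhds hs.2] with u hu
      simp [c, h₂.left (u - 1) (by linarith [Set.mem_Iio.1 hu])]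
    simp only [this.eq_of_nhds, this.deriv_eq]
  have e₂ : g.arcLength c 1 2 = g.arcLength c₂ 0 1 := by
    have : g.arcLength c 1 2 = g.arcLength (c₂ ∘ fun s => s - 1) 1 2 := by
      refine intervalIntegral.integral_congr_Ioo_of_le one_le_two fun s hs => ?_
      have : c =ᶠ[nhds s] (c₂ ∘ fun s => s - 1) := by
        filter_upwards [Ioi_mem_nhds hs.1] with u hu
        simp [c, h₁.right u (le_of_lt hu)]
      simp only [this.eq_of_nhds, this.deriv_eq]
    rw [this, g.arcLength_comp (ψ := fun s => s - 1) h₂.contDiff (contDiff_id.sub contDiff_const)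
      (fun _ _ h => sub_le_sub_right h 1)]
    norm_num
  have := g.rdist_le_arcLength hc (zero_le_two (α := ℝ))
  rw [← g.arcLength_add hc 0 1 2, e₁, e₂] at this
  have hz : c 0 = z := by simp [c, h₁.left 0 le_rfl, h₂.left (-1) (by norm_num)]
  have hw : c 2 = w := by
    simp only [c, h₁.right 2 one_le_two]
    rw [h₂.right _ (by norm_num)]
    ring
  rw [hz, hw] at this
  linarith

theorem arcLength_reverse (c : ℝ → ℂ) : g.arcLength (fun s => c (1 - s)) 0 1 = g.arcLength c 0 1 := by
  have h (s : ℝ) : g.speed (c (1 - s)) (deriv (fun s => c (1 - s)) s) =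
      (fun s => g.speed (c s) (deriv c s)) (1 - s) := by
    rw [deriv_comp_const_sub, speed_neg]
  simp only [arcLength, h]
  rw [intervalIntegral.integral_comp_sub_left (fun s => g.speed (c s) (deriv c s))]
  norm_num

theorem rdist_comm (z w : ℂ) : g.rdist z w = g.rdist w z := by
  suffices ∀ z w, g.rdist z w ≤ g.rdist w z from le_antisymm (this z w) (this w z)
  refine fun z w => g.le_rdist fun c hc => ?_
  rw [← g.arcLength_reverse]
  have := g.rdist_le_arcLength (c := fun s => c (1 - s))
    (hc.contDiff.comp (contDiff_const.sub contDiff_id)) zero_le_one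
  simpa [hc.left, hc.right] using this

theorem rdist_glide_le (z w : ℂ) : g.rdist (glide z) (glide w) ≤ g.rdist z w := by
  refine g.le_rdist fun c hc => ?_
  have hd : ContDiff ℝ 1 fun s => glide (c s) :=
    ((Complex.conjCLE : ℂ →L[ℝ] ℂ).contDiff.comp hc.contDiff).add contDiff_const
  have := g.rdist_le_arcLength hd zero_le_one
  rw [hc.left 0 le_rfl, hc.right 1 le_rfl] at this
  refine this.trans_eq (intervalIntegral.integral_congr fun s _ => ?_)
  have h1 : HasDerivAt (fun s => glide (c s)) (conj (deriv c s)) s :=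
    (hasFDerivAt_glide (c s)).comp_hasDerivAt s
      ((hc.contDiff.differentiable one_ne_zero) s).hasDerivAt
  simp only [h1.deriv]
  exact g.speed_glide _ _

theorem rdist_add_le {τ : ℂ} (hτ : Function.Periodic g.form τ) (z w : ℂ) :
    g.rdist (z + τ) (w + τ) ≤ g.rdist z w := by
  refine g.le_rdist fun c hc => ?_
  have := g.rdist_le_arcLength (hc.contDiff.add (contDiff_const (c := τ))) zero_le_one
  rw [hc.left 0 le_rfl, hc.right 1 le_rfl] at this
  refine this.trans_eq (intervalIntegral.integral_congr fun s _ => ?_)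
  simp only [deriv_add_const, speed, hτ (c s)]

theorem rdist_add {τ : ℂ} (hτ : Function.Periodic g.form τ) (z w : ℂ) :
    g.rdist (z + τ) (w + τ) = g.rdist z w :=
  le_antisymm (g.rdist_add_le hτ z w) (by simpa using g.rdist_add_le hτ.neg (z + τ) (w + τ))

theorem rdist_glide (z w : ℂ) : g.rdist (glide z) (glide w) = g.rdist z w := by
  refine le_antisymm (g.rdist_glide_le z w) ?_
  have h (z : ℂ) : glide (glide z) = z + 2 * Real.pi := by simp [glide]; ring
  rw [← g.rdist_add (τ := 2 * Real.pi) g.form_add_two_pi, ← h, ← h]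
  exact g.rdist_glide_le _ _

theorem rdist_le_of_speed_le {z v : ℂ} {M : ℝ}
    (h : ∀ s ∈ Set.Icc (0 : ℝ) 1, g.speed (z + s * v) v ≤ M) : g.rdist z (z + v) ≤ M := by
  have hd (s : ℝ) : HasDerivAt (fun s : ℝ => z + s * v) v s := by
    simpa using (((hasDerivAt_id s).ofReal_comp).mul_const v).const_add z
  have hc : ContDiff ℝ 1 fun s : ℝ => z + s * v :=
    contDiff_const.add ((Complex.ofRealCLM.contDiff (n := 1)).mul contDiff_const)
  have := g.rdist_le_arcLength hc zero_le_one
  simp only [Complex.ofReal_zero, zero_mul, add_zero, Complex.ofReal_one, one_mul] at this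
  refine this.trans ?_
  have := intervalIntegral.integral_mono_on zero_le_one
    ((g.continuous_speed_deriv hc).intervalIntegrable 0 1)
    (continuous_const.intervalIntegrable 0 1 :
      IntervalIntegrable (fun _ => M) MeasureTheory.volume 0 1)
    (fun s hs => by rw [(hd s).deriv]; exact h s hs)
  simpa [arcLength] using this

theorem leastLength_le_rdist {γ : Equiv.Perm ℂ} (hγ : γ ∈ kleinGroup) (z : ℂ) :
    g.leastLength γ ≤ g.rdist z (γ z) := by
  refine g.le_rdist fun c hc => csInf_le ⟨0, ?_⟩ ?_
  · rintro _ ⟨d, -, rfl⟩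
    exact g.arcLength_nonneg d zero_le_one
  · exact ⟨⟨c, hc.contDiff.continuous⟩, mem_freeHomotopyClass hγ hc.contDiff
      (by simp [hc.left, hc.right]), rfl⟩

theorem leastLengthPowers_le_rdist {γ δ : Equiv.Perm ℂ} (hγ : γ ∈ kleinGroup)
    (hδ : δ ∈ Subgroup.zpowers γ) (h1 : δ ≠ 1) (z : ℂ) :
    g.leastLengthPowers γ ≤ g.rdist z (δ z) := by
  refine g.le_rdist fun c hc => csInf_le ⟨0, ?_⟩ ?_
  · rintro _ ⟨d, -, rfl⟩
    exact g.arcLength_nonneg d zero_le_one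
  · exact ⟨⟨c, hc.contDiff.continuous⟩, ⟨δ, hδ, h1, mem_freeHomotopyClass
      (Subgroup.zpowers_le.2 hγ hδ) hc.contDiff (by simp [hc.left, hc.right])⟩, rfl⟩

theorem Lσ_nonneg : 0 ≤ g.Lσ := Real.sInf_nonneg (by
  rintro _ ⟨d, -, rfl⟩
  exact g.arcLength_nonneg d zero_le_one)

theorem lv_nonneg : 0 ≤ g.lv := Real.sInf_nonneg (by
  rintro _ ⟨d, -, rfl⟩
  exact g.arcLength_nonneg d zero_le_one)

theorem lv_le_rdist (z : ℂ) : g.lv ≤ g.rdist z (z + 2 * Complex.I) :=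
  g.leastLength_le_rdist vert_mem_kleinGroup z

theorem Lσ_le_rdist_glide (z : ℂ) : g.Lσ ≤ g.rdist z (glide z) := by
  refine g.leastLengthPowers_le_rdist glide_mem_kleinGroup (Subgroup.mem_zpowers glide) ?_ z
  intro h
  simpa [glide, Real.pi_ne_zero] using congr($h 0)

theorem Lσ_le_rdist_two_pi (z : ℂ) : g.Lσ ≤ g.rdist z (z + 2 * Real.pi) := by
  have h (z : ℂ) : (glide ^ 2) z = z + 2 * Real.pi := by simp [sq, glide]; ring
  rw [← h]
  refine g.leastLengthPowers_le_rdist glide_mem_kleinGroup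
    (Subgroup.npow_mem_zpowers glide 2) (fun h' => ?_) z
  have := h 0
  simp [h', Real.pi_ne_zero] at this

end KleinMetric

end

/-! ### Lower bounds for the distance along the translation lattice. -/

noncomputable section

open ComplexConjugate

/-- The vector `2 π a + 2 b i` of the translation lattice. -/
def latticeVec (a b : ℤ) : ℂ := a * (2 * Real.pi) + b * (2 * Complex.I)

theorem latticeVec_add (a b a' b' : ℤ) :
    latticeVec (a + a') (b + b') = latticeVec a b + latticeVec a' b' := by
  simp [latticeVec]; ring

theorem latticeVec_neg (a b : ℤ) : latticeVec (-a) (-b) = -latticeVec a b := by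
  simp [latticeVec]; ring

theorem conj_latticeVec (a b : ℤ) : conj (latticeVec a b) = latticeVec a (-b) := by
  simp [latticeVec, map_ofNat]

theorem natCast_mul_latticeVec (n : ℕ) (a b : ℤ) :
    n * latticeVec a b = latticeVec (n * a) (n * b) := by
  simp [latticeVec]; ring

theorem glide_add (z v : ℂ) : glide (z + v) = glide z + conj v := by
  simp [glide]; ring

theorem glide_glide (z : ℂ) : glide (glide z) = z + 2 * Real.pi := by simp [glide]; ring

theorem glide_add_latticeVec (z : ℂ) (a b : ℤ) :
    glide (z + latticeVec a b) = glide z + latticeVec a (-b) := by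
  rw [glide_add, conj_latticeVec]

theorem Function.Periodic.latticeVec {α : Type*} {f : ℂ → α}
    (h₁ : Function.Periodic f (2 * Real.pi)) (h₂ : Function.Periodic f (2 * Complex.I)) (a b : ℤ) :
    Function.Periodic f (latticeVec a b) := by
  simpa only [_root_.latticeVec, zsmul_eq_mul] using (h₁.zsmul a).add_period (h₂.zsmul b)

namespace KleinMetric

variable (g : KleinMetric)

theorem periodic_form (a b : ℤ) : Function.Periodic g.form (latticeVec a b) :=
  Function.Periodic.latticeVec g.form_add_two_pi g.form_vert a b

theorem rdist_add_latticeVec (z w : ℂ) (a b : ℤ) :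
    g.rdist (z + latticeVec a b) (w + latticeVec a b) = g.rdist z w :=
  g.rdist_add (g.periodic_form a b) z w

variable {g}

/-- Cut a path at the ends of a half chord. The middle arc joins points that differ by τ; the two
outer arcs, after translating the last one by -τ, join z to z + τ through the start of the chord.
Each contributes at least m. -/
theorem two_mul_le_rdist {τ : ℂ} (hτ : Function.Periodic g.form τ) {m : ℝ}
    (h : ∀ z, m ≤ g.rdist z (z + τ)) (z : ℂ) : 2 * m ≤ g.rdist z (z + 2 * τ) := by
  refine g.le_rdist fun c hc => ?_
  obtain ⟨s, s', h0, hs, h1, hv⟩ := exists_chord_eq_half hc.contDiff.continuous (v := τ)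
    (by rw [hc.left 0 le_rfl, hc.right 1 le_rfl])
  have e₁ := g.rdist_le_arcLength hc.contDiff h0
  have e₂ := g.rdist_le_arcLength hc.contDiff hs
  have e₃ := g.rdist_le_arcLength hc.contDiff h1
  rw [hc.left 0 le_rfl] at e₁
  rw [hv] at e₂ e₃
  rw [hc.right 1 le_rfl, two_mul, ← add_assoc, g.rdist_add hτ] at e₃
  linarith [h z, h (c s), g.rdist_triangle z (c s) (z + τ), g.arcLength_add hc.contDiff 0 s s',
    g.arcLength_add hc.contDiff 0 s' 1]

theorem two_pow_mul_le_rdist {τ : ℂ} (hτ : Function.Periodic g.form τ) {m : ℝ}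
    (h : ∀ z, m ≤ g.rdist z (z + τ)) (k : ℕ) (z : ℂ) :
    2 ^ k * m ≤ g.rdist z (z + 2 ^ k * τ) := by
  induction k generalizing z with
  | zero => simpa using h z
  | succ k ih =>
    have hk : Function.Periodic g.form (2 ^ k * τ) := by simpa using hτ.nsmul (2 ^ k)
    have := two_mul_le_rdist hk ih z
    rwa [← mul_assoc, ← mul_assoc, ← pow_succ', ← pow_succ'] at this

/-- Fekete's lemma: d(z, z + nτ)/n is never below its limit, and the limit can be computed along
powers of 2, where doubling applies. -/
theorem natCast_mul_le_rdist {τ : ℂ} (hτ : Function.Periodic g.form τ) {m : ℝ}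
    (h : ∀ z, m ≤ g.rdist z (z + τ)) (n : ℕ) (z : ℂ) : n * m ≤ g.rdist z (z + n * τ) := by
  set u : ℕ → ℝ := fun n => g.rdist z (z + n * τ) with hu
  have hsub : Subadditive u := fun i j => by
    have hi : Function.Periodic g.form (i * τ) := by simpa using hτ.nsmul i
    have h1 := g.rdist_triangle z (z + i * τ) (z + i * τ + j * τ)
    have h2 := g.rdist_add hi z (z + j * τ)
    rw [add_right_comm] at h2
    rw [h2, add_assoc, ← add_mul] at h1
    simpa [hu] using h1
  have hbdd : BddBelow (Set.range fun n => u n / n) := ⟨0, by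
    rintro _ ⟨n, rfl⟩
    exact div_nonneg (g.rdist_nonneg _ _) n.cast_nonneg⟩
  have hlim : m ≤ hsub.lim := by
    refine ge_of_tendsto' ((hsub.tendsto_lim hbdd).comp
      (tendsto_pow_atTop_atTop_of_one_lt one_lt_two)) fun k => ?_
    have := two_pow_mul_le_rdist hτ h k z
    simp only [Function.comp_apply, hu]
    rw [le_div_iff₀ (by positivity)]
    push_cast
    linarith
  rcases eq_or_ne n 0 with rfl | hn
  · simpa using g.rdist_nonneg z z
  have := hlim.trans (hsub.lim_le_div hbdd hn)
  rwa [le_div_iff₀ (by positivity), mul_comm] at this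

theorem abs_intCast_mul_le_rdist {τ : ℂ} (hτ : Function.Periodic g.form τ) {m : ℝ}
    (h : ∀ z, m ≤ g.rdist z (z + τ)) (n : ℤ) (z : ℂ) : |(n : ℝ)| * m ≤ g.rdist z (z + n * τ) := by
  obtain ⟨n, rfl | rfl⟩ := n.eq_nat_or_neg
  · simpa using natCast_mul_le_rdist hτ h n z
  · have := natCast_mul_le_rdist hτ h n (z + -n * τ)
    rw [g.rdist_comm] at this
    simpa using this

variable (g)

theorem rdist_natCast_mul_le (n : ℕ) (z : ℂ) (a b : ℤ) :
    g.rdist z (z + n * latticeVec a b) ≤ n * g.rdist z (z + latticeVec a b) := by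
  induction n with
  | zero => simp [rdist_self]
  | succ n ih =>
    have h1 := g.rdist_triangle z (z + n * latticeVec a b) (z + (n + 1 : ℕ) * latticeVec a b)
    have h2 := g.rdist_add_latticeVec z (z + latticeVec a b) (n * a) (n * b)
    rw [← natCast_mul_latticeVec, add_assoc, ← one_add_mul, add_comm (1 : ℂ)] at h2
    push_cast at h1 ⊢
    linarith

/-- Go n steps along one lattice vector, cross to the orbit of σz, go n steps along the reflected
vector, and cross back. The crossings cost an amount independent of n, and `le_rdist_of_reflect`
removes it by letting n grow. -/
theorem rdist_reflect_le (n : ℕ) (z : ℂ) (a b a' b' : ℤ)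
    (h : g.rdist (glide z) (glide z + n * latticeVec a' b') =
      g.rdist z (z + n * latticeVec a b)) :
    g.rdist z (z + n * latticeVec (a + a') (b + b')) ≤
      2 * n * g.rdist z (z + latticeVec a b) + 2 * g.rdist z (glide z) := by
  have t₁ := g.rdist_triangle z (z + n * latticeVec a b) (z + n * latticeVec (a + a') (b + b'))
  have t₂ := g.rdist_triangle (z + n * latticeVec a b) (glide z + n * latticeVec a b)
    (z + n * latticeVec (a + a') (b + b'))
  have t₃ := g.rdist_triangle (glide z + n * latticeVec a b)
    (glide z + n * latticeVec (a + a') (b + b')) (z + n * latticeVec (a + a') (b + b'))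
  have e₁ := g.rdist_natCast_mul_le n z a b
  have e₂ := g.rdist_add_latticeVec z (glide z) (n * a) (n * b)
  have e₃ := g.rdist_add_latticeVec (glide z) z (n * (a + a')) (n * (b + b'))
  have e₄ := g.rdist_add_latticeVec (glide z) (glide z + n * latticeVec a' b') (n * a) (n * b)
  rw [← natCast_mul_latticeVec] at e₂ e₃ e₄
  rw [add_right_comm, add_assoc (glide z), ← mul_add, ← latticeVec_add] at e₄
  rw [g.rdist_comm (glide z)] at e₃
  linarith

theorem le_rdist_of_reflect {z : ℂ} {a b : ℤ} {x : ℝ}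
    (h : ∀ n : ℕ, 2 * n * x ≤ 2 * n * g.rdist z (z + latticeVec a b) + 2 * g.rdist z (glide z)) :
    x ≤ g.rdist z (z + latticeVec a b) := by
  by_contra! hlt
  obtain ⟨n, hn⟩ := exists_nat_gt (g.rdist z (glide z) / (x - g.rdist z (z + latticeVec a b)))
  rw [div_lt_iff₀ (sub_pos.2 hlt)] at hn
  linarith [h n]

theorem abs_mul_Lσ_le_rdist (z : ℂ) (a b : ℤ) : |(a : ℝ)| * g.Lσ ≤ g.rdist z (z + latticeVec a b) := by
  refine g.le_rdist_of_reflect fun n => ?_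
  -- The vector (a, b) plus its mirror image (a, -b) is purely horizontal.
  have h := g.rdist_reflect_le n z a b a (-b) (by
    rw [natCast_mul_latticeVec, mul_neg, ← glide_add_latticeVec, rdist_glide,
      natCast_mul_latticeVec])
  refine le_trans ?_ h
  have := abs_intCast_mul_le_rdist (g := g) g.form_add_two_pi g.Lσ_le_rdist_two_pi (2 * n * a) z
  refine le_of_eq_of_le ?_ (this.trans_eq ?_)
  · push_cast
    rw [abs_mul, abs_mul]
    simp
    ring
  · congr 2
    simp [latticeVec]
    ring

theorem abs_mul_lv_le_rdist (z : ℂ) (a b : ℤ) : |(b : ℝ)| * g.lv ≤ g.rdist z (z + latticeVec a b) := by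
  refine g.le_rdist_of_reflect fun n => ?_
  -- Here (a, b) is added to minus its mirror image; minus is harmless because the distance is
  -- symmetric.
  have h := g.rdist_reflect_le n z a b (-a) b (by
    rw [natCast_mul_latticeVec, natCast_mul_latticeVec]
    have := glide_add_latticeVec z (n * -a) (-(n * b))
    rw [neg_neg] at this
    rw [← this, rdist_glide, mul_neg, latticeVec_neg, g.rdist_comm]
    have := g.rdist_add_latticeVec (z + -latticeVec (n * a) (n * b)) z (n * a) (n * b)
    rwa [neg_add_cancel_right, eq_comm] at this)
  refine le_trans ?_ h
  have := abs_intCast_mul_le_rdist (g := g) g.form_vert g.lv_le_rdist (2 * n * b) z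
  refine le_of_eq_of_le ?_ (this.trans_eq ?_)
  · push_cast
    rw [abs_mul, abs_mul]
    simp
    ring
  · congr 2
    simp [latticeVec]
    ring

end KleinMetric

end

/-! ### Lipschitz functions with prescribed periods, and their smoothing. -/

noncomputable section

open ComplexConjugate

/-- A compact fundamental box of the translation lattice. -/
def latticeBox : Set ℂ := Set.Icc 0 (2 * Real.pi) ×ℂ Set.Icc 0 2

theorem isCompact_latticeBox : IsCompact latticeBox := isCompact_Icc.reProdIm isCompact_Icc

theorem zero_mem_latticeBox : (0 : ℂ) ∈ latticeBox := by
  simp [latticeBox, Complex.mem_reProdIm, Real.pi_pos.le]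

theorem exists_add_latticeVec_mem (z : ℂ) : ∃ a b : ℤ, z + latticeVec a b ∈ latticeBox := by
  obtain ⟨a, ha, -⟩ := existsUnique_add_zsmul_mem_Ico Real.two_pi_pos z.re 0
  obtain ⟨b, hb, -⟩ := existsUnique_add_zsmul_mem_Ico (zero_lt_two (α := ℝ)) z.im 0
  refine ⟨a, b, ?_, ?_⟩
  · simpa [latticeVec] using Set.Ico_subset_Icc_self ha
  · simpa [latticeVec] using Set.Ico_subset_Icc_self hb

namespace KleinMetric

variable (g : KleinMetric)

theorem speed_add_latticeVec (z v : ℂ) (a b : ℤ) :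
    g.speed (z + latticeVec a b) v = g.speed z v := by
  rw [speed, g.periodic_form a b z, speed]

theorem speed_eq_norm_mul (z : ℂ) {v : ℂ} (hv : v ≠ 0) :
    g.speed z v = ‖v‖ * g.speed z (‖v‖⁻¹ • v) := by
  have : ‖v‖ ≠ 0 := norm_ne_zero_iff.2 hv
  rw [speed_smul, abs_of_nonneg (by positivity)]
  field_simp

theorem norm_inv_smul_mem_sphere {v : ℂ} (hv : v ≠ 0) : ‖v‖⁻¹ • v ∈ Metric.sphere (0 : ℂ) 1 := by
  simp [norm_ne_zero_iff.2 hv]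

theorem exists_speed_le : ∃ M > 0, ∀ z v, g.speed z v ≤ M * ‖v‖ := by
  obtain ⟨x, -, hmax⟩ := (isCompact_latticeBox.prod (isCompact_sphere (0 : ℂ) 1)).exists_isMaxOn
    ⟨(0, 1), zero_mem_latticeBox, by simp⟩ g.continuous_speed.continuousOn
  refine ⟨g.speed x.1 x.2 + 1, by linarith [g.speed_nonneg x.1 x.2], fun z v => ?_⟩
  rcases eq_or_ne v 0 with rfl | hv
  · simp [speed]
  obtain ⟨a, b, hz⟩ := exists_add_latticeVec_mem z
  rw [← g.speed_add_latticeVec z v a b, speed_eq_norm_mul _ _ hv, mul_comm]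
  refine mul_le_mul_of_nonneg_right ?_ (norm_nonneg v)
  have : g.speed (z + latticeVec a b) (‖v‖⁻¹ • v) ≤ g.speed x.1 x.2 :=
    hmax (Set.mk_mem_prod hz (norm_inv_smul_mem_sphere hv))
  linarith

theorem exists_le_speed : ∃ m > 0, ∀ z v, m * ‖v‖ ≤ g.speed z v := by
  obtain ⟨x, hx, hmin⟩ := (isCompact_latticeBox.prod (isCompact_sphere (0 : ℂ) 1)).exists_isMinOn
    ⟨(0, 1), zero_mem_latticeBox, by simp⟩ g.continuous_speed.continuousOn
  refine ⟨g.speed x.1 x.2, g.speed_pos _ ?_, fun z v => ?_⟩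
  · rintro h0
    simpa [h0] using hx.2
  rcases eq_or_ne v 0 with rfl | hv
  · simp [speed]
  obtain ⟨a, b, hz⟩ := exists_add_latticeVec_mem z
  rw [← g.speed_add_latticeVec z v a b, speed_eq_norm_mul _ _ hv, mul_comm]
  exact mul_le_mul_of_nonneg_left (hmin (Set.mk_mem_prod hz (norm_inv_smul_mem_sphere hv)))
    (norm_nonneg v)

theorem exists_speed_le_one_add_mul {δ : ℝ} (hδ : 0 < δ) :
    ∃ ε > 0, ∀ z w v, dist w z < ε → g.speed w v ≤ (1 + δ) * g.speed z v := by
  obtain ⟨m, hm, hmv⟩ := g.exists_le_speed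
  have huc := ((isCompact_latticeBox.cthickening (r := 1)).prod
    (isCompact_sphere (0 : ℂ) 1)).uniformContinuousOn_of_continuous g.continuous_speed.continuousOn
  obtain ⟨ε, hε, h⟩ := Metric.uniformContinuousOn_iff.1 huc (δ * m) (mul_pos hδ hm)
  refine ⟨min ε 1, lt_min hε one_pos, fun z w v hzw => ?_⟩
  rcases eq_or_ne v 0 with rfl | hv
  · simp [speed]
  obtain ⟨a, b, hz⟩ := exists_add_latticeVec_mem z
  have hd : dist (w + latticeVec a b) (z + latticeVec a b) < min ε 1 := by simpa using hzw
  have hs := norm_inv_smul_mem_sphere hv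
  have := h (w + latticeVec a b, ‖v‖⁻¹ • v)
    (Set.mk_mem_prod (Metric.mem_cthickening_of_dist_le _ _ _ _ hz
      (hd.le.trans (min_le_right _ _))) hs)
    (z + latticeVec a b, ‖v‖⁻¹ • v)
    (Set.mk_mem_prod (Metric.self_subset_cthickening _ hz) hs)
    (by rw [Prod.dist_eq, dist_self]; exact max_lt (hd.trans_le (min_le_left _ _)) hε)
  simp only [Real.dist_eq, speed_add_latticeVec] at this
  have h1 := (abs_lt.1 this).2
  have h2 := hmv z (‖v‖⁻¹ • v)
  rw [mem_sphere_zero_iff_norm.1 hs, mul_one] at h2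
  rw [speed_eq_norm_mul _ _ hv, speed_eq_norm_mul _ z hv, mul_left_comm]
  refine mul_le_mul_of_nonneg_left ?_ (norm_nonneg v)
  nlinarith

/-- `1`-Lipschitz functions for the Riemannian distance. -/
def IsRLip (f : ℂ → ℝ) : Prop := ∀ z w, f z ≤ f w + g.rdist z w

variable {g}

theorem IsRLip.exists_lipschitzWith {f : ℂ → ℝ} (hf : g.IsRLip f) :
    ∃ K : NNReal, LipschitzWith K f := by
  obtain ⟨M, hM, h⟩ := g.exists_speed_le
  refine ⟨⟨M, hM.le⟩, LipschitzWith.of_le_add_mul _ fun x y => (hf x y).trans ?_⟩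
  rw [rdist_comm]
  have := g.rdist_le_of_speed_le (z := y) (v := x - y) fun s _ => h _ _
  rw [add_sub_cancel] at this
  rw [dist_eq_norm]
  exact add_le_add le_rfl this

theorem isRLip_rdist (z₀ : ℂ) : g.IsRLip fun z => g.rdist z z₀ := fun z w => by
  linarith [g.rdist_triangle z w z₀]

theorem IsRLip.min_const {f : ℂ → ℝ} (hf : g.IsRLip f) (C : ℝ) :
    g.IsRLip fun z => min (f z) C := fun z w => by
  rw [← min_add_add_right]
  exact min_le_min (hf z w) (le_add_of_nonneg_right (g.rdist_nonneg _ _))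

open MeasureTheory ContDiffBump in
/-- Smoothing of a `1`-Lipschitz function. -/
theorem IsRLip.exists_contDiff {f : ℂ → ℝ} (hf : g.IsRLip f) {δ : ℝ} (hδ : 0 < δ) :
    ∃ F : ℂ → ℝ, ContDiff ℝ ∞ F ∧ (∀ z v, |fderiv ℝ F z v| ≤ (1 + δ) * g.speed z v) ∧
      (∀ z, |F z - f z| ≤ δ) ∧ ∀ τ A, (∀ z, f (z + τ) = f z + A) → ∀ z, F (z + τ) = F z + A := by
  obtain ⟨K, hK⟩ := hf.exists_lipschitzWith
  -- ε₁ controls the variation of the metric over the support of the kernel, hence the differential;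
  -- ε₂ controls the uniform distance to f.
  obtain ⟨ε₁, hε₁, hsp⟩ := g.exists_speed_le_one_add_mul hδ
  obtain ⟨ε₂, hε₂, hKε⟩ : ∃ ε₂ > 0, K * ε₂ ≤ δ :=
    ⟨δ / (K + 1), by positivity, by
      rw [mul_div_assoc', div_le_iff₀ (by positivity)]; nlinarith [K.2]⟩
  set ε := min (ε₁ / 2) ε₂ with hε
  have hε0 : 0 < ε := by positivity
  let η : ContDiffBump (0 : ℂ) := ⟨ε / 2, ε, by positivity, by linarith⟩
  let F : ℂ → ℝ := convolution (η.normed volume) f (ContinuousLinearMap.lsmul ℝ ℝ) volume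
  have hFdef (z) : F z = ∫ w, η.normed volume w * f (z - w) := by
    simp [F, convolution_def]
  have hint {k : ℂ → ℝ} (hk : Continuous k) : Integrable fun w => η.normed volume w * k w :=
    ((η.contDiff_normed (n := 0)).continuous.mul hk).integrable_of_hasCompactSupport
      η.hasCompactSupport_normed.mul_right
  have hsmooth : ContDiff ℝ ∞ F := η.hasCompactSupport_normed.contDiff_convolution_left _
    η.contDiff_normed hK.continuous.locallyIntegrable
  have hup (z v : ℂ) : fderiv ℝ F z v ≤ (1 + δ) * g.speed z v := by
    have hd : HasDerivAt (fun t : ℝ => F (z + t • v)) (fderiv ℝ F z v) 0 := by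
      have h1 : HasDerivAt (fun t : ℝ => z + t • v) v 0 := by
        simpa using ((hasDerivAt_id (0 : ℝ)).smul_const v).const_add z
      have h2 : HasFDerivAt F (fderiv ℝ F z) (z + (0 : ℝ) • v) := by
        simpa using ((hsmooth.differentiable (by simp)) z).hasFDerivAt
      exact h2.comp_hasDerivAt (0 : ℝ) h1
    refine le_of_tendsto hd.tendsto_slope_zero_right ?_
    have hsmall : ∀ᶠ t : ℝ in nhdsWithin 0 (Set.Ioi 0), ‖t • v‖ < ε₁ / 2 := by
      refine (Continuous.tendsto' (by fun_prop) (0 : ℝ) 0 (by simp)).eventually_lt_const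
        (half_pos hε₁) |>.filter_mono nhdsWithin_le_nhds
    filter_upwards [hsmall, self_mem_nhdsWithin] with t ht ht0
    have ht0 : 0 < t := ht0
    simp only [zero_add, zero_smul, add_zero, smul_eq_mul]
    have hfc := hK.continuous
    rw [inv_mul_le_iff₀ ht0, hFdef, hFdef, ← integral_sub (hint (by fun_prop)) (hint (by fun_prop))]
    have hc : t * ((1 + δ) * g.speed z v) =
        ∫ w, η.normed volume w * (t * ((1 + δ) * g.speed z v)) := by
      rw [integral_mul_const, η.integral_normed, one_mul]
    rw [hc]
    refine integral_mono ((hint (by fun_prop)).sub (hint (by fun_prop))) (hint (by fun_prop))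
      fun w => ?_
    rw [← mul_sub]
    by_cases hw : w ∈ Metric.ball (0 : ℂ) ε
    · refine mul_le_mul_of_nonneg_left ?_ (η.nonneg_normed w)
      have h1 := hf (z - w + t • v) (z - w)
      rw [g.rdist_comm] at h1
      have h2 : g.rdist (z - w) (z - w + t • v) ≤ t * ((1 + δ) * g.speed z v) := by
        refine g.rdist_le_of_speed_le fun s hs => ?_
        rw [speed_smul, abs_of_pos ht0]
        refine mul_le_mul_of_nonneg_left (hsp _ _ _ ?_) ht0.le
        have e : z - w + s * t • v - z = -w + (s : ℂ) * (t • v) := by ring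
        rw [dist_eq_norm, e]
        refine (norm_add_le _ _).trans_lt ?_
        rw [norm_neg, norm_mul, Complex.norm_real, Real.norm_eq_abs, abs_of_nonneg hs.1]
        have hw' : ‖w‖ < ε₁ / 2 := (mem_ball_zero_iff.1 hw).trans_le (min_le_left _ _)
        nlinarith [norm_nonneg (t • v), hs.2]
      rw [show z + t • v - w = z - w + t • v by ring]
      linarith
    · have : η.normed volume w = 0 := by
        rw [← Function.notMem_support, η.support_normed_eq]
        exact hw
      simp [this]
  refine ⟨F, hsmooth, fun z v => abs_le.2 ⟨?_, hup z v⟩, fun z => ?_, fun τ A h z => ?_⟩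
  · have := hup z (-v)
    rw [map_neg, speed_neg] at this
    linarith
  · rw [← Real.dist_eq]
    refine dist_normed_convolution_le hK.continuous.aestronglyMeasurable fun x hx => ?_
    refine (hK.dist_le_mul x z).trans (le_trans ?_ hKε)
    exact mul_le_mul_of_nonneg_left ((Metric.mem_ball.1 hx).le.trans (min_le_right _ _)) K.2
  · have hfc := hK.continuous
    rw [hFdef, hFdef]
    have this (w : ℂ) : η.normed volume w * f (z + τ - w) =
        η.normed volume w * f (z - w) + η.normed volume w * A := by
      rw [add_sub_right_comm, h, mul_add]
    simp_rw [this]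
    rw [integral_add (hint (by fun_prop)) (hint (by fun_prop)), integral_mul_const,
      η.integral_normed, one_mul]

variable (g) in
/-- A `1`-Lipschitz function with prescribed periods. -/
theorem exists_isRLip_period {A B : ℝ}
    (h : ∀ z (a b : ℤ), |a * A + b * B| ≤ g.rdist z (z + latticeVec a b)) :
    ∃ f : ℂ → ℝ, g.IsRLip f ∧ ∀ (a b : ℤ) z, f (z + latticeVec a b) = f z + (a * A + b * B) := by
  -- A McShane extension of the additive function from the lattice. The hypothesis `h` bounds the
  -- infimum from below, and shifting the index produces the periods.
  let F : ℂ → ℤ × ℤ → ℝ := fun z p => g.rdist z (latticeVec p.1 p.2) + (p.1 * A + p.2 * B)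
  have hbdd (z) : BddBelow (Set.range (F z)) := by
    refine ⟨-g.rdist z 0, ?_⟩
    rintro _ ⟨p, rfl⟩
    have h1 := h 0 p.1 p.2
    have h2 := g.rdist_triangle 0 z (latticeVec p.1 p.2)
    rw [zero_add] at h1
    rw [g.rdist_comm 0 z] at h2
    simp only [F]
    linarith [(abs_le.1 h1).1, neg_abs_le (p.1 * A + p.2 * B : ℝ)]
  refine ⟨fun z => ⨅ p, F z p, fun z w => ?_, fun a b z => ?_⟩
  · rw [ciInf_add (hbdd w)]
    refine le_ciInf fun p => (ciInf_le (hbdd z) p).trans ?_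
    simp only [F]
    linarith [g.rdist_triangle z w (latticeVec p.1 p.2)]
  · simp only
    rw [ciInf_add (hbdd z), ← (Equiv.addRight (a, b)).iInf_comp]
    refine iInf_congr fun p => ?_
    simp only [F, Equiv.coe_addRight, Prod.fst_add, Prod.snd_add, latticeVec_add,
      rdist_add_latticeVec]
    push_cast
    ring

variable (g) in
/-- Smooth functions whose differential has norm at most one. -/
structure IsShort (f : ℂ → ℝ) : Prop where
  contDiff : ContDiff ℝ ∞ f
  abs_fderiv_le : ∀ z v, |fderiv ℝ f z v| ≤ g.speed z v

theorem IsShort.comp_glide {f : ℂ → ℝ} (hf : g.IsShort f) : g.IsShort (f ∘ glide) := by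
  refine ⟨hf.contDiff.comp ((Complex.conjCLE : ℂ →L[ℝ] ℂ).contDiff.add contDiff_const),
    fun z v => ?_⟩
  rw [(((hf.contDiff.differentiable (by simp)) (glide z)).hasFDerivAt.comp z
    (hasFDerivAt_glide z)).fderiv, ← g.speed_glide]
  exact hf.abs_fderiv_le _ _

/-- Serves to symmetrize under σ: with f₂ = f₁ ∘ σ, the sign s = 1 suits the horizontal function and
s = -1 the vertical one. -/
theorem IsShort.average {f₁ f₂ : ℂ → ℝ} (h₁ : g.IsShort f₁) (h₂ : g.IsShort f₂) {s : ℝ}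
    (hs : |s| = 1) (C : ℝ) : g.IsShort fun z => (f₁ z + s * f₂ z + C) / 2 := by
  refine ⟨((h₁.contDiff.add (contDiff_const.mul h₂.contDiff)).add contDiff_const).div_const 2,
    fun z v => ?_⟩
  have d₁ := ((h₁.contDiff.differentiable (by simp)) z).hasFDerivAt
  have d₂ := ((h₂.contDiff.differentiable (by simp)) z).hasFDerivAt
  have := (((d₁.add (d₂.const_mul s)).add_const C).mul_const (2⁻¹ : ℝ))
  simp only [← div_eq_mul_inv] at this
  rw [HasFDerivAt.fderiv (f := fun z => (f₁ z + s * f₂ z + C) / 2) this]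
  simp only [smul_apply, add_apply, smul_eq_mul]
  rw [abs_mul, abs_inv, abs_two, inv_mul_le_iff₀ two_pos]
  refine (abs_add_le _ _).trans ?_
  rw [abs_mul, hs]
  linarith [h₁.abs_fderiv_le z v, h₂.abs_fderiv_le z v]

theorem IsRLip.exists_isShort {f : ℂ → ℝ} (hf : g.IsRLip f) {θ : ℝ} (h0 : 0 < θ) (h1 : θ < 1) :
    ∃ F : ℂ → ℝ, g.IsShort F ∧
      ∀ τ A, (∀ z, f (z + τ) = f z + A) → ∀ z, F (z + τ) = F z + θ * A := by
  -- With δ = 1/θ - 1, multiplication by θ exactly undoes the factor 1 + δ lost in smoothing.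
  have hδ : 0 < θ⁻¹ - 1 := sub_pos.2 ((one_lt_inv₀ h0).2 h1)
  obtain ⟨F, hF, hb, -, hp⟩ := hf.exists_contDiff hδ
  refine ⟨fun z => θ * F z, ⟨contDiff_const.mul hF, fun z v => ?_⟩, fun τ A h z => ?_⟩
  · rw [fderiv_const_mul ((hF.differentiable (by simp)) z)]
    rw [smul_apply, smul_eq_mul, abs_mul, abs_of_pos h0]
    refine (mul_le_mul_of_nonneg_left (hb z v) h0.le).trans_eq ?_
    field_simp
    ring
  · simp only [hp τ A h z, mul_add]

variable (g) in
/-- Almost optimal calibrating functions in the horizontal direction. -/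
theorem exists_horizontal {θ : ℝ} (h0 : 0 < θ) (h1 : θ < 1) :
    ∃ f : ℂ → ℝ, g.IsShort f ∧ (∀ z, f (z + 2 * Real.pi) = f z + θ * g.Lσ) ∧
      (∀ z, f (z + 2 * Complex.I) = f z) ∧ ∀ z, f (glide z) = f z + θ * g.Lσ / 2 := by
  obtain ⟨f, hf, hp⟩ := g.exists_isRLip_period (A := g.Lσ) (B := 0) fun z a b => by
    simpa [abs_mul, abs_of_nonneg g.Lσ_nonneg] using g.abs_mul_Lσ_le_rdist z a b
  obtain ⟨F, hF, hFp⟩ := hf.exists_isShort h0 h1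
  have p₁ : ∀ z, F (z + 2 * Real.pi) = F z + θ * g.Lσ := hFp _ _ fun z => by
    simpa [latticeVec] using hp 1 0 z
  have p₂ : ∀ z, F (z + 2 * Complex.I) = F z := fun z => by
    simpa using hFp (2 * Complex.I) 0 (fun z => by simpa [latticeVec] using hp 0 1 z) z
  refine ⟨_, hF.average hF.comp_glide abs_one (-(θ * g.Lσ / 2)), fun z => ?_, fun z => ?_,
    fun z => ?_⟩
  · simp only [Function.comp_apply, glide_add, map_mul, map_ofNat, Complex.conj_ofReal, p₁]
    ring
  · have h (z) : F (z + 2 * -Complex.I) = F z := by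
      rw [← p₂ (z + 2 * -Complex.I)]; congr 1; ring
    simp only [Function.comp_apply, glide_add, map_mul, map_ofNat, Complex.conj_I, p₂, h]
  · simp only [Function.comp_apply, glide_glide, p₁]
    ring

variable (g) in
/-- Almost optimal calibrating functions in the vertical direction. -/
theorem exists_vertical {θ : ℝ} (h0 : 0 < θ) (h1 : θ < 1) :
    ∃ f : ℂ → ℝ, g.IsShort f ∧ (∀ z, f (z + 2 * Real.pi) = f z) ∧
      (∀ z, f (z + 2 * Complex.I) = f z + θ * g.lv) ∧ ∀ z, f (glide z) = -f z := by
  obtain ⟨f, hf, hp⟩ := g.exists_isRLip_period (A := 0) (B := g.lv) fun z a b => by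
    simpa [abs_mul, abs_of_nonneg g.lv_nonneg] using g.abs_mul_lv_le_rdist z a b
  obtain ⟨F, hF, hFp⟩ := hf.exists_isShort h0 h1
  have p₁ : ∀ z, F (z + 2 * Real.pi) = F z := fun z => by
    simpa using hFp (2 * Real.pi) 0 (fun z => by simpa [latticeVec] using hp 1 0 z) z
  have p₂ : ∀ z, F (z + 2 * Complex.I) = F z + θ * g.lv := hFp _ _ fun z => by
    simpa [latticeVec] using hp 0 1 z
  refine ⟨_, hF.average hF.comp_glide (s := -1) (by simp) 0, fun z => ?_, fun z => ?_,
    fun z => ?_⟩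
  · simp only [Function.comp_apply, glide_add, map_mul, map_ofNat, Complex.conj_ofReal, p₁]
  · have h (z) : F (z + 2 * -Complex.I) = F z - θ * g.lv := by
      rw [eq_sub_iff_add_eq, ← p₂ (z + 2 * -Complex.I)]; congr 1; ring
    simp only [Function.comp_apply, glide_add, map_mul, map_ofNat, Complex.conj_I, p₂, h]
    ring
  · simp only [Function.comp_apply, glide_glide, p₁]
    ring

end KleinMetric

end

/-! ### Green's formula, the area density, and the upper bound. -/

noncomputable section

open MeasureTheory Complex

theorem setIntegral_reProdIm {φ : ℂ → ℝ} (hφ : Continuous φ) {a b c d : ℝ} (hab : a ≤ b)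
    (hcd : c ≤ d) :
    ∫ z in Set.Icc a b ×ℂ Set.Icc c d, φ z = ∫ x in a..b, ∫ y in c..d, φ (x + y * I) := by
  have hs : Set.Icc a b ×ℂ Set.Icc c d =
      measurableEquivRealProd ⁻¹' (Set.Icc a b ×ˢ Set.Icc c d) := rfl
  let ψ : ℝ × ℝ → ℝ := fun p => φ (p.1 + p.2 * I)
  have hψ : Continuous ψ := by fun_prop
  have h1 : ∀ z, φ z = ψ (measurableEquivRealProd z) := fun z => by
    simp [ψ, measurableEquivRealProd_apply, re_add_im]
  simp_rw [h1]
  rw [hs, volume_preserving_equiv_real_prod.setIntegral_preimage_emb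
    measurableEquivRealProd.measurableEmbedding ψ, Measure.volume_eq_prod, setIntegral_prod ψ
    (hψ.continuousOn.integrableOn_compact (isCompact_Icc.prod isCompact_Icc)),
    integral_Icc_eq_integral_Ioc, ← intervalIntegral.integral_of_le hab]
  refine intervalIntegral.integral_congr fun x _ => ?_
  rw [integral_Icc_eq_integral_Ioc, ← intervalIntegral.integral_of_le hcd]
  simp [ψ, measurableEquivRealProd_apply]

/-- The Jacobian determinant of `(u, v)`. -/
def jac (u v : ℂ → ℝ) (z : ℂ) : ℝ :=
  fderiv ℝ u z 1 * fderiv ℝ v z I - fderiv ℝ u z I * fderiv ℝ v z 1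

theorem continuous_jac {u v : ℂ → ℝ} (hu : ContDiff ℝ ∞ u) (hv : ContDiff ℝ ∞ v) :
    Continuous (jac u v) := by
  have h1 := hu.continuous_fderiv (by simp)
  have h2 := hv.continuous_fderiv (by simp)
  unfold jac
  fun_prop

/-- Green's formula for `du ∧ dv` on a rectangle. -/
theorem integral_jac {u v : ℂ → ℝ} (hu : ContDiff ℝ ∞ u) (hv : ContDiff ℝ ∞ v) {a b c d : ℝ}
    (hab : a ≤ b) (hcd : c ≤ d) :
    ∫ z in Set.Icc a b ×ℂ Set.Icc c d, jac u v z =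
      ((∫ x in a..b, -(u (x + d * I) * fderiv ℝ v (x + d * I) 1)) -
        ∫ x in a..b, -(u (x + c * I) * fderiv ℝ v (x + c * I) 1)) +
      (∫ y in c..d, u (b + y * I) * fderiv ℝ v (b + y * I) I) -
        ∫ y in c..d, u (a + y * I) * fderiv ℝ v (a + y * I) I := by
  rw [setIntegral_reProdIm (continuous_jac hu hv) hab hcd]
  let E : ℝ × ℝ →L[ℝ] ℂ := equivRealProdCLM.symm
  have hE (p : ℝ × ℝ) : E p = p.1 + p.2 * I := equivRealProdCLM_symm_apply p
  have hE1 : E (1, 0) = 1 := by simp [hE]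
  have hEI : E (0, 1) = I := by simp [hE]
  have hdv : ContDiff ℝ ∞ (fderiv ℝ v) := hv.fderiv_right (by simp)
  have du (p) : HasFDerivAt (fun p => u (E p)) ((fderiv ℝ u (E p)).comp E) p :=
    ((hu.differentiable (by simp)) (E p)).hasFDerivAt.comp p E.hasFDerivAt
  have dv (p) (e : ℂ) : HasFDerivAt (fun p => fderiv ℝ v (E p) e)
      (((fderiv ℝ (fderiv ℝ v) (E p)).comp E).flip e) p := by
    have h1 : HasFDerivAt (fun p => fderiv ℝ v (E p)) ((fderiv ℝ (fderiv ℝ v) (E p)).comp E) p :=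
      ((hdv.differentiable (by simp)) (E p)).hasFDerivAt.comp p E.hasFDerivAt
    simpa using h1.clm_apply (hasFDerivAt_const e p)
  have symm (z) : fderiv ℝ (fderiv ℝ v) z 1 I = fderiv ℝ (fderiv ℝ v) z I 1 :=
    (hv.contDiffAt.isSymmSndFDerivAt
      (by rw [minSmoothness_of_isRCLikeNormedField]; exact WithTop.coe_le_coe.2 (le_top (a := (2 : ℕ∞))))) 1 I
  have key := integral2_divergence_prod_of_hasFDerivAt
    (fun p => u (E p) * fderiv ℝ v (E p) I) (fun p => -(u (E p) * fderiv ℝ v (E p) 1)) _ _ a c b d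
    ((hu.continuous.comp E.continuous).mul
      (((hdv.continuous.comp E.continuous).clm_apply continuous_const))).continuousOn
    ((hu.continuous.comp E.continuous).mul
      (((hdv.continuous.comp E.continuous).clm_apply continuous_const))).neg.continuousOn
    (fun p _ => (du p).mul (dv p I)) (fun p _ => ((du p).mul (dv p 1)).neg) ?_
  · simp only [hE] at key
    rw [← key]
    refine intervalIntegral.integral_congr fun x _ => intervalIntegral.integral_congr fun y _ => ?_
    simp [hE1, hEI, symm, jac]
    ring
  · refine ContinuousOn.integrableOn_compact (isCompact_uIcc.prod isCompact_uIcc)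
      (Continuous.continuousOn ?_)
    have c0 := hu.continuous
    have c1 := hu.continuous_fderiv (by simp)
    have c2 := hdv.continuous
    have c3 := hdv.continuous_fderiv (by simp)
    simp only [add_apply, smul_apply, neg_apply, ContinuousLinearMap.flip_apply,
      ContinuousLinearMap.comp_apply, hE1, hEI]
    fun_prop

theorem integral_fderiv_vertical {v : ℂ → ℝ} (hv : ContDiff ℝ ∞ v) (x c d : ℝ) :
    ∫ y in c..d, fderiv ℝ v (x + y * I) I = v (x + d * I) - v (x + c * I) := by
  refine intervalIntegral.integral_eq_sub_of_hasDerivAt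
    (f := fun y : ℝ => v (x + y * I)) (fun y _ => ?_) ?_
  · have h1 : HasDerivAt (fun y : ℝ => (x : ℂ) + y * I) I y := by
      simpa using (((hasDerivAt_id y).ofReal_comp).mul_const I).const_add (x : ℂ)
    exact ((hv.differentiable (by simp)) (x + y * I)).hasFDerivAt.comp_hasDerivAt y h1
  · have h1 := hv.continuous_fderiv (by simp)
    exact Continuous.intervalIntegrable (by fun_prop) _ _

theorem integral_jac_eq_of_boundary {u v : ℂ → ℝ} (hu : ContDiff ℝ ∞ u) (hv : ContDiff ℝ ∞ v)
    {a b c d k : ℝ} (hab : a ≤ b) (hcd : c ≤ d) (hl : ∀ y ∈ Set.Icc c d, u (a + y * I) = 0)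
    (hr : ∀ y ∈ Set.Icc c d, u (b + y * I) = k)
    (hb : ∀ x ∈ Set.Icc a b, fderiv ℝ v (x + c * I) 1 = 0)
    (ht : ∀ x ∈ Set.Icc a b, fderiv ℝ v (x + d * I) 1 = 0) :
    ∫ z in Set.Icc a b ×ℂ Set.Icc c d, jac u v z = k * (v (b + d * I) - v (b + c * I)) := by
  have e₁ : ∫ x in a..b, -(u (x + d * I) * fderiv ℝ v (x + d * I) 1) = ∫ x in a..b, 0 :=
    intervalIntegral.integral_congr fun x hx => by
      rw [Set.uIcc_of_le hab] at hx; simp [ht x hx]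
  have e₂ : ∫ x in a..b, -(u (x + c * I) * fderiv ℝ v (x + c * I) 1) = ∫ x in a..b, 0 :=
    intervalIntegral.integral_congr fun x hx => by
      rw [Set.uIcc_of_le hab] at hx; simp [hb x hx]
  have e₃ : ∫ y in c..d, u (b + y * I) * fderiv ℝ v (b + y * I) I =
      ∫ y in c..d, k * fderiv ℝ v (b + y * I) I :=
    intervalIntegral.integral_congr fun y hy => by
      rw [Set.uIcc_of_le hcd] at hy; simp only [hr y hy]
  have e₄ : ∫ y in c..d, u (a + y * I) * fderiv ℝ v (a + y * I) I = ∫ y in c..d, 0 :=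
    intervalIntegral.integral_congr fun y hy => by
      rw [Set.uIcc_of_le hcd] at hy; simp [hl y hy]
  rw [integral_jac hu hv hab hcd, e₁, e₂, e₃, e₄, intervalIntegral.integral_const_mul,
    integral_fderiv_vertical hv]
  simp


theorem fderiv_add_period {v : ℂ → ℝ} {τ : ℂ} {A : ℝ} (h : ∀ z, v (z + τ) = v z + A) (z : ℂ) :
    fderiv ℝ v (z + τ) = fderiv ℝ v z := by
  rw [← fderiv_comp_add_right, show (fun z => v (z + τ)) = fun z => v z + A from funext h,
    fderiv_add_const]

theorem add_natCast_mul_period {v : ℂ → ℝ} {τ : ℂ} {A : ℝ} (h : ∀ z, v (z + τ) = v z + A) (n : ℕ)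
    (z : ℂ) : v (z + n * τ) = v z + n * A := by
  induction n with
  | zero => simp
  | succ n ih =>
    have := h (z + n * τ)
    rw [ih, add_assoc] at this
    push_cast
    rw [add_one_mul, this]
    ring

/-- The square of `(2N)²` fundamental domains of the translation lattice centered at `0`. -/
def latticeRect (N : ℕ) : Set ℂ :=
  Set.Icc (-(N * (2 * Real.pi))) (N * (2 * Real.pi)) ×ℂ Set.Icc (-(N * 2)) (N * 2)

theorem isCompact_latticeRect (N : ℕ) : IsCompact (latticeRect N) :=
  isCompact_Icc.reProdIm isCompact_Icc

/-- In Green's formula for u dv the horizontal sides cancel. On the vertical sides u differs by 2NA,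
and v increases by 2NB along them. -/
theorem integral_jac_of_periods {u v : ℂ → ℝ} (hu : ContDiff ℝ ∞ u) (hv : ContDiff ℝ ∞ v)
    {A B : ℝ} (hu₁ : ∀ z, u (z + 2 * Real.pi) = u z + A) (hu₂ : ∀ z, u (z + 2 * I) = u z)
    (hv₁ : ∀ z, v (z + 2 * Real.pi) = v z) (hv₂ : ∀ z, v (z + 2 * I) = v z + B) (N : ℕ) :
    ∫ z in latticeRect N, jac u v z = 4 * N ^ 2 * (A * B) := by
  have hπ := Real.pi_pos
  have hn : (0 : ℝ) ≤ N := N.cast_nonneg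
  have hab : -(N * (2 * Real.pi)) ≤ (N * (2 * Real.pi)) := by nlinarith [mul_nonneg hn hπ.le]
  have hcd : -((N : ℝ) * 2) ≤ N * 2 := by linarith
  have eu₁ (y : ℝ) : u ((N * (2 * Real.pi) : ℝ) + y * I) =
      u ((-(N * (2 * Real.pi)) : ℝ) + y * I) + 2 * N * A := by
    have := add_natCast_mul_period hu₁ (2 * N) ((-(N * (2 * Real.pi)) : ℝ) + y * I)
    push_cast at this ⊢
    rw [← this]
    congr 1
    ring
  have eu₂ (x : ℝ) : u (x + (N * 2 : ℝ) * I) = u (x + (-(N * 2) : ℝ) * I) := by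
    have := add_natCast_mul_period (A := 0) (by simpa using hu₂) (2 * N) (x + (-(N * 2) : ℝ) * I)
    rw [mul_zero, add_zero] at this
    rw [← this]
    congr 1
    push_cast
    ring
  have ev₂ (x : ℝ) : v (x + (N * 2 : ℝ) * I) = v (x + (-(N * 2) : ℝ) * I) + 2 * N * B := by
    have := add_natCast_mul_period hv₂ (2 * N) (x + (-(N * 2) : ℝ) * I)
    push_cast at this ⊢
    rw [← this]
    congr 1
    ring
  have dv₁ (y : ℝ) : fderiv ℝ v ((N * (2 * Real.pi) : ℝ) + y * I) =
      fderiv ℝ v ((-(N * (2 * Real.pi)) : ℝ) + y * I) := by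
    have := fderiv_add_period (A := ((2 * N : ℕ) : ℝ) * 0)
      (add_natCast_mul_period (A := 0) (by simpa using hv₁) (2 * N))
      ((-(N * (2 * Real.pi)) : ℝ) + y * I)
    rw [← this]
    congr 1
    push_cast
    ring
  have dv₂ (x : ℝ) : fderiv ℝ v (x + (N * 2 : ℝ) * I) = fderiv ℝ v (x + (-(N * 2) : ℝ) * I) := by
    have := fderiv_add_period (add_natCast_mul_period hv₂ (2 * N)) (x + (-(N * 2) : ℝ) * I)
    rw [← this]
    congr 1
    push_cast
    ring
  have hcv := hv.continuous_fderiv (by simp)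
  have hcu := hu.continuous
  rw [latticeRect, integral_jac hu hv hab hcd]
  simp only [eu₂, dv₂, sub_self, zero_add]
  rw [← intervalIntegral.integral_sub (Continuous.intervalIntegrable (by fun_prop) _ _)
    (Continuous.intervalIntegrable (by fun_prop) _ _)]
  simp only [eu₁, dv₁, ← sub_mul, add_sub_cancel_left]
  rw [intervalIntegral.integral_const_mul, integral_fderiv_vertical hv, ev₂]
  ring

namespace KleinMetric

variable (g : KleinMetric)

/-- The density of the Riemannian area. -/
def density (z : ℂ) : ℝ := √(g.form z 1 1 * g.form z I I - g.form z 1 I ^ 2)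

theorem continuous_density : Continuous g.density := by
  have := g.continuous_form
  unfold density
  fun_prop

theorem form_apply (z v : ℂ) : g.form z v v =
    v.re ^ 2 * g.form z 1 1 + 2 * v.re * v.im * g.form z 1 I + v.im ^ 2 * g.form z I I := by
  have hv : v = v.re • (1 : ℂ) + v.im • I := by simp [re_add_im]
  conv_lhs => rw [hv]
  simp only [map_add, map_smul, add_apply, smul_apply, smul_eq_mul, g.symm z I 1]
  ring

theorem det_pos (z : ℂ) : 0 < g.form z 1 1 * g.form z I I - g.form z 1 I ^ 2 := by
  have h1 := g.pos z 1 one_ne_zero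
  have h2 := g.pos z (⟨-g.form z 1 I, g.form z 1 1⟩ : ℂ) (by
    intro h
    have := congrArg Complex.im h
    simp only [Complex.zero_im] at this
    linarith)
  rw [form_apply] at h2
  simp only at h2
  have : 0 < g.form z 1 1 * (g.form z 1 1 * g.form z I I - g.form z 1 I ^ 2) := by linarith
  exact (mul_pos_iff_of_pos_left h1).1 this

theorem density_pos (z : ℂ) : 0 < g.density z := Real.sqrt_pos.2 (g.det_pos z)

/-- Hadamard's inequality for two covectors of norm at most one. Testing α on the kernel direction
of β bounds the squared wedge by S; testing β on a multiple of its own metric dual bounds S by the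
determinant. -/
theorem abs_wedge_le_density {z : ℂ} {α β : ℂ →L[ℝ] ℝ} (hα : ∀ v, |α v| ≤ g.speed z v)
    (hβ : ∀ v, |β v| ≤ g.speed z v) : |α 1 * β I - α I * β 1| ≤ g.density z := by
  have sq {α : ℂ →L[ℝ] ℝ} (hα : ∀ v, |α v| ≤ g.speed z v) (v : ℂ) :
      (v.re * α 1 + v.im * α I) ^ 2 ≤ g.form z v v := by
    have hv : v = v.re • (1 : ℂ) + v.im • I := by simp [re_add_im]
    have h1 : α v = v.re * α 1 + v.im * α I := by
      conv_lhs => rw [hv]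
      simp only [map_add, map_smul, smul_eq_mul]
    rw [← h1, ← g.sq_speed, ← sq_abs]
    exact pow_le_pow_left₀ (abs_nonneg _) (hα v) 2
  set E := g.form z 1 1 with hE
  set F := g.form z 1 I with hF
  set G := g.form z I I with hG
  have hdet : 0 < E * G - F ^ 2 := g.det_pos z
  have h1 := sq hα ⟨β I, -β 1⟩
  have h2 := sq hβ ⟨G * β 1 - F * β I, -F * β 1 + E * β I⟩
  rw [form_apply] at h1 h2
  simp only [← hE, ← hF, ← hG] at h1 h2
  set S := β 1 ^ 2 * G - 2 * β 1 * β I * F + β I ^ 2 * E with hS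
  have h3 : (α 1 * β I - α I * β 1) ^ 2 ≤ S := by rw [hS]; linarith
  have h4 : S ^ 2 ≤ (E * G - F ^ 2) * S := by rw [hS]; linarith
  have h5 : S ≤ E * G - F ^ 2 := by
    rcases (sq_nonneg _ |>.trans h3).eq_or_lt with h0 | h0
    · rw [← h0]; exact hdet.le
    · exact le_of_mul_le_mul_right (by linarith) h0
  exact Real.le_sqrt_of_sq_le (by rw [sq_abs]; exact h3.trans h5)

variable {g} in
theorem IsShort.abs_jac_le {u v : ℂ → ℝ} (hu : g.IsShort u) (hv : g.IsShort v) (z : ℂ) :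
    |jac u v z| ≤ g.density z :=
  g.abs_wedge_le_density (hu.abs_fderiv_le z) (hv.abs_fderiv_le z)

theorem density_add_latticeVec (z : ℂ) (a b : ℤ) :
    g.density (z + latticeVec a b) = g.density z := by
  rw [density, g.periodic_form a b z, density]

theorem density_glide (z : ℂ) : g.density (glide z) = g.density z := by
  have h (v w : ℂ) : g.form (glide z) v w = g.form z (starRingEnd ℂ v) (starRingEnd ℂ w) := by
    rw [← g.form_glide z, conj_conj, conj_conj]; rfl
  simp [density, h]

theorem vol_eq : g.vol = ∫ x in 0..Real.pi, ∫ y in (0 : ℝ)..2, g.density (x + y * I) := by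
  rw [← setIntegral_reProdIm g.continuous_density Real.pi_pos.le zero_le_two, vol]
  refine setIntegral_congr_set ?_
  have hs (s t : Set ℝ) : s ×ℂ t = measurableEquivRealProd ⁻¹' (s ×ˢ t) := rfl
  rw [hs, hs]
  refine volume_preserving_equiv_real_prod.quasiMeasurePreserving.preimage_ae_eq ?_
  exact Measure.set_prod_ae_eq Ico_ae_eq_Icc Ico_ae_eq_Icc

theorem vol_pos : 0 < g.vol := by
  have hc := g.continuous_density
  rw [vol_eq]
  refine intervalIntegral.intervalIntegral_pos_of_pos (Continuous.intervalIntegrable ?_ _ _)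
    (fun x => ?_) Real.pi_pos
  · exact intervalIntegral.continuous_parametric_intervalIntegral_of_continuous'
      (f := fun (x y : ℝ) => g.density (x + y * I)) (by unfold Function.uncurry; fun_prop) 0 2
  · exact intervalIntegral.intervalIntegral_pos_of_pos
      (Continuous.intervalIntegrable (by fun_prop) _ _) (fun y => g.density_pos _) two_pos

/-- The rectangle has 4N² lattice cells, each made of two fundamental domains. The integral over a
vertical period is π-periodic in x, because σ flips y and preserves the density. -/
theorem integral_density_latticeRect (N : ℕ) :
    ∫ z in latticeRect N, g.density z = 8 * N ^ 2 * g.vol := by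
  have hπ := Real.pi_pos
  have hn : (0 : ℝ) ≤ N := N.cast_nonneg
  have hab : -(N * (2 * Real.pi)) ≤ (N * (2 * Real.pi)) := by nlinarith [mul_nonneg hn hπ.le]
  have hcd : -((N : ℝ) * 2) ≤ N * 2 := by linarith
  have hc := g.continuous_density
  set V : ℝ → ℝ := fun x => ∫ y in (0 : ℝ)..2, g.density (x + y * I) with hV
  have hper (x : ℝ) : Function.Periodic (fun y : ℝ => g.density (x + y * I)) 2 := fun y => by
    have := g.density_add_latticeVec (x + y * I) 0 1
    refine Eq.trans (congrArg g.density ?_) this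
    simp [latticeVec]
    ring
  have hVc : Continuous V :=
    intervalIntegral.continuous_parametric_intervalIntegral_of_continuous'
      (f := fun (x y : ℝ) => g.density (x + y * I)) (by unfold Function.uncurry; fun_prop) 0 2
  have hVp : Function.Periodic V Real.pi := fun x => by
    have h1 (y : ℝ) : g.density ((x + Real.pi : ℝ) + y * I) =
        (fun y : ℝ => g.density (x + y * I)) (-y) := by
      rw [← g.density_glide]
      have := g.density_add_latticeVec (x + (-y : ℝ) * I) 1 0
      refine Eq.trans (congrArg g.density ?_) this
      simp [glide, latticeVec]
      ring
    simp only [hV, h1]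
    rw [intervalIntegral.integral_comp_neg (fun y : ℝ => g.density (x + y * I))]
    have := (hper x).intervalIntegral_add_eq (-2) 0
    simpa using this
  rw [latticeRect, setIntegral_reProdIm hc hab hcd]
  have e₁ (x : ℝ) : ∫ y in -((N : ℝ) * 2)..N * 2, g.density (x + y * I) = 2 * N * V x := by
    have := (hper x).intervalIntegral_add_zsmul_eq (2 * N : ℕ) (-(N * 2))
      (fun _ _ => Continuous.intervalIntegrable (by fun_prop) _ _)
    rw [(hper x).intervalIntegral_add_eq _ 0, zero_add] at this
    simp only [zsmul_eq_mul, Int.cast_natCast] at this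
    rw [show -((N : ℝ) * 2) + (2 * N : ℕ) * 2 = N * 2 by push_cast; ring] at this
    rw [this]
    push_cast
    rfl
  simp only [e₁]
  rw [intervalIntegral.integral_const_mul]
  have := hVp.intervalIntegral_add_zsmul_eq (4 * N : ℕ) (-(N * (2 * Real.pi)))
      (fun _ _ => hVc.intervalIntegrable _ _)
  rw [hVp.intervalIntegral_add_eq _ 0, zero_add, ← vol_eq] at this
  simp only [zsmul_eq_mul, Int.cast_natCast] at this
  rw [show -((N : ℝ) * (2 * Real.pi)) + (4 * N : ℕ) * Real.pi = N * (2 * Real.pi) by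
    push_cast; ring] at this
  rw [this]
  push_cast
  ring

theorem Lσ_mul_lv_le : g.Lσ * g.lv ≤ 2 * g.vol := by
  have key {θ : ℝ} (h0 : 0 < θ) (h1 : θ < 1) : θ ^ 2 * (g.Lσ * g.lv) ≤ 2 * g.vol := by
    obtain ⟨f, hf, hf₁, hf₂, -⟩ := g.exists_horizontal h0 h1
    obtain ⟨h, hh, hh₁, hh₂, -⟩ := g.exists_vertical h0 h1
    have e₁ := integral_jac_of_periods hf.contDiff hh.contDiff hf₁ hf₂ hh₁ hh₂ 1
    have e₂ := g.integral_density_latticeRect 1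
    have : ∫ z in latticeRect 1, jac f h z ≤ ∫ z in latticeRect 1, g.density z :=
      integral_mono
        ((continuous_jac hf.contDiff hh.contDiff).continuousOn.integrableOn_compact
          (isCompact_latticeRect 1))
        (g.continuous_density.continuousOn.integrableOn_compact (isCompact_latticeRect 1))
        fun z => (le_abs_self _).trans (hf.abs_jac_le hh z)
    rw [e₁, e₂] at this
    push_cast at this
    linarith
  have hlim : Filter.Tendsto (fun θ : ℝ => θ ^ 2 * (g.Lσ * g.lv)) (nhdsWithin 1 (Set.Iio 1))
      (nhds (g.Lσ * g.lv)) :=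
    (Continuous.tendsto' (by fun_prop) _ _ (by simp)).mono_left nhdsWithin_le_nhds
  refine le_of_tendsto hlim ?_
  filter_upwards [Ioo_mem_nhdsLT (zero_lt_one (α := ℝ))] with θ hθ using key hθ.1 hθ.2

end KleinMetric

end

/-! ### The transport inequality. -/

noncomputable section

open MeasureTheory Complex

/-- A nonnegative smooth function supported in an interval has a smooth primitive that is constant
on both sides of the interval. -/
theorem exists_primitive {φ : ℝ → ℝ} (hφ : ContDiff ℝ ∞ φ) {α β C : ℝ} (hαβ : α ≤ β)
    (h0 : ∀ x, 0 ≤ φ x) (hC : ∀ x, φ x ≤ C) (hl : ∀ x ≤ α, φ x = 0) (hr : ∀ x, β ≤ x → φ x = 0) :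
    ∃ (P : ℝ → ℝ) (k : ℝ), ContDiff ℝ ∞ P ∧ (∀ x, HasDerivAt P (φ x) x) ∧ (∀ x ≤ α, P x = 0) ∧
      (∀ x, β ≤ x → P x = k) ∧ (∀ x, P x ∈ Set.Icc 0 k) ∧ k ≤ C * (β - α) := by
  let P : ℝ → ℝ := fun x => ∫ t in α..x, φ t
  have hd (x) : HasDerivAt P (φ x) x :=
    intervalIntegral.integral_hasDerivAt_right (hφ.continuous.intervalIntegrable _ _)
      hφ.continuous.stronglyMeasurable.stronglyMeasurableAtFilter hφ.continuous.continuousAt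
  have hdP : deriv P = φ := funext fun x => (hd x).deriv
  have hm : Monotone P := monotone_of_deriv_nonneg (fun x => (hd x).differentiableAt)
    fun x => by rw [hdP]; exact h0 x
  have hPl : ∀ x ≤ α, P x = 0 := fun x hx => by
    have : ∫ t in α..x, φ t = ∫ t in α..x, 0 := intervalIntegral.integral_congr fun t ht => by
      rw [Set.uIcc_of_ge hx] at ht; exact hl t ht.2
    simpa using this
  have hPr : ∀ x, β ≤ x → P x = P β := fun x hx => by
    have : ∫ t in β..x, φ t = ∫ t in β..x, 0 := intervalIntegral.integral_congr fun t ht => by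
      rw [Set.uIcc_of_le hx] at ht; exact hr t ht.1
    simp only [P]
    rw [← intervalIntegral.integral_add_adjacent_intervals
      (hφ.continuous.intervalIntegrable α β) (hφ.continuous.intervalIntegrable β x), this]
    simp
  refine ⟨P, P β, ?_, hd, hPl, hPr, fun x => ⟨?_, ?_⟩, ?_⟩
  · rw [contDiff_infty_iff_deriv, hdP]
    exact ⟨fun x => (hd x).differentiableAt, hφ⟩
  · rw [← hPl (min x α) (min_le_right _ _)]
    exact hm (min_le_left _ _)
  · rw [← hPr (max x β) (le_max_right _ _)]
    exact hm (le_max_left _ _)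
  · have := intervalIntegral.integral_mono_on hαβ (hφ.continuous.intervalIntegrable α β)
      (continuous_const.intervalIntegrable α β : IntervalIntegrable (fun _ => C) volume α β)
      fun x _ => hC x
    simpa [mul_comm] using this

theorem hasFDerivAt_comp_primitive {P φ : ℝ → ℝ} (hP : ∀ x, HasDerivAt P (φ x) x) {f : ℂ → ℝ}
    (hf : ContDiff ℝ ∞ f) (z : ℂ) :
    HasFDerivAt (fun z => P (f z)) (φ (f z) • fderiv ℝ f z) z :=
  (hP (f z)).comp_hasFDerivAt z ((hf.differentiable (by simp)) z).hasFDerivAt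

/-- The pullback of `φ dx ∧ ψ dy` under a map that sends the sides of a rectangle outside of the
supports has the same integral as the form. -/
theorem integral_mul_mul_jac {f h : ℂ → ℝ} (hf : ContDiff ℝ ∞ f) (hh : ContDiff ℝ ∞ h)
    {φ ψ P Q : ℝ → ℝ} {α β γ δ k q : ℝ} (hP : ContDiff ℝ ∞ P) (hQ : ContDiff ℝ ∞ Q)
    (dP : ∀ x, HasDerivAt P (φ x) x) (dQ : ∀ x, HasDerivAt Q (ψ x) x)
    (hPl : ∀ x ≤ α, P x = 0) (hPr : ∀ x, β ≤ x → P x = k)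
    (hQl : ∀ x ≤ γ, Q x = 0) (hQr : ∀ x, δ ≤ x → Q x = q)
    (hψl : ∀ x ≤ γ, ψ x = 0) (hψr : ∀ x, δ ≤ x → ψ x = 0)
    {a b c d : ℝ} (hab : a ≤ b) (hcd : c ≤ d)
    (hl : ∀ y ∈ Set.Icc c d, f (a + y * I) ≤ α) (hr : ∀ y ∈ Set.Icc c d, β ≤ f (b + y * I))
    (hb : ∀ x ∈ Set.Icc a b, h (x + c * I) ≤ γ) (ht : ∀ x ∈ Set.Icc a b, δ ≤ h (x + d * I)) :
    ∫ z in Set.Icc a b ×ℂ Set.Icc c d, φ (f z) * ψ (h z) * jac f h z = k * q := by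
  have d₁ := hasFDerivAt_comp_primitive dP hf
  have d₂ := hasFDerivAt_comp_primitive dQ hh
  have := integral_jac_eq_of_boundary (u := fun z => P (f z)) (v := fun z => Q (h z)) (hP.comp hf)
    (hQ.comp hh) (k := k) hab hcd (fun y hy => hPl _ (hl y hy)) (fun y hy => hPr _ (hr y hy))
    (fun x hx => by simp [(d₂ _).fderiv, hψl _ (hb x hx)])
    (fun x hx => by simp [(d₂ _).fderiv, hψr _ (ht x hx)])
  rw [hQr _ (ht b (Set.right_mem_Icc.2 hab)), hQl _ (hb b (Set.right_mem_Icc.2 hab)),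
    sub_zero] at this
  rw [← this]
  refine setIntegral_congr_fun (isCompact_Icc.reProdIm isCompact_Icc).measurableSet fun z _ => ?_
  simp only [jac, (d₁ z).fderiv, (d₂ z).fderiv, smul_apply, smul_eq_mul]
  ring

/-- Stokes for u φ(f) ψ(h) dh, which vanishes along the boundary of the rectangle. It trades the
derivative of φ for the differential of u. -/
theorem integral_transport_jac {f h u : ℂ → ℝ} (hf : ContDiff ℝ ∞ f) (hh : ContDiff ℝ ∞ h)
    (hu : ContDiff ℝ ∞ u)
    {φ φ' ψ Q : ℝ → ℝ} {α β γ δ : ℝ} (hφ : ContDiff ℝ ∞ φ) (hQ : ContDiff ℝ ∞ Q)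
    (dφ : ∀ x, HasDerivAt φ (φ' x) x) (dQ : ∀ x, HasDerivAt Q (ψ x) x)
    (hφl : ∀ x ≤ α, φ x = 0) (hφr : ∀ x, β ≤ x → φ x = 0)
    (hψl : ∀ x ≤ γ, ψ x = 0) (hψr : ∀ x, δ ≤ x → ψ x = 0)
    {a b c d : ℝ} (hab : a ≤ b) (hcd : c ≤ d)
    (hl : ∀ y ∈ Set.Icc c d, f (a + y * I) ≤ α) (hr : ∀ y ∈ Set.Icc c d, β ≤ f (b + y * I))
    (hb : ∀ x ∈ Set.Icc a b, h (x + c * I) ≤ γ) (ht : ∀ x ∈ Set.Icc a b, δ ≤ h (x + d * I)) :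
    ∫ z in Set.Icc a b ×ℂ Set.Icc c d,
      (φ (f z) * ψ (h z) * jac u h z + u z * (φ' (f z) * ψ (h z)) * jac f h z) = 0 := by
  have d₁ := hasFDerivAt_comp_primitive dφ hf
  have d₂ := hasFDerivAt_comp_primitive dQ hh
  have d₃ (z) := ((hu.differentiable (by simp)) z).hasFDerivAt.mul (d₁ z)
  have := integral_jac_eq_of_boundary (u := fun z => u z * φ (f z)) (v := fun z => Q (h z))
    (hu.mul (hφ.comp hf)) (hQ.comp hh) (k := 0) hab hcd
    (fun y hy => by simp [hφl _ (hl y hy)]) (fun y hy => by simp [hφr _ (hr y hy)])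
    (fun x hx => by simp [(d₂ _).fderiv, hψl _ (hb x hx)])
    (fun x hx => by simp [(d₂ _).fderiv, hψr _ (ht x hx)])
  rw [zero_mul] at this
  rw [← this]
  refine setIntegral_congr_fun (isCompact_Icc.reProdIm isCompact_Icc).measurableSet fun z _ => ?_
  have h3 := HasFDerivAt.fderiv (f := fun z => u z * φ (f z)) (d₃ z)
  simp only [jac, h3, (d₂ z).fderiv, add_apply, smul_apply, smul_eq_mul]
  ring

namespace KleinMetric

variable {g : KleinMetric}

theorem IsShort.isRLip {f : ℂ → ℝ} (hf : g.IsShort f) : g.IsRLip f := fun z w => by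
  rw [← sub_le_iff_le_add', g.rdist_comm]
  refine g.le_rdist fun c hc => ?_
  have hd (s : ℝ) : HasDerivAt (fun s => f (c s)) (fderiv ℝ f (c s) (deriv c s)) s :=
    ((hf.contDiff.differentiable (by simp)) (c s)).hasFDerivAt.comp_hasDerivAt s
      ((hc.contDiff.differentiable one_ne_zero) s).hasDerivAt
  have hcont : Continuous fun s => fderiv ℝ f (c s) (deriv c s) :=
    ((hf.contDiff.continuous_fderiv (by simp)).comp hc.contDiff.continuous).clm_apply
      (hc.contDiff.continuous_deriv le_rfl)
  have := intervalIntegral.integral_eq_sub_of_hasDerivAt (a := 0) (b := 1) (fun s _ => hd s)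
    (hcont.intervalIntegrable _ _)
  rw [hc.left 0 le_rfl, hc.right 1 le_rfl] at this
  rw [← this]
  exact intervalIntegral.integral_mono zero_le_one (hcont.intervalIntegrable _ _)
    ((g.continuous_speed_deriv hc.contDiff).intervalIntegrable _ _)
    fun s => (le_abs_self _).trans (hf.abs_fderiv_le _ _)

theorem IsRLip.abs_sub_le {f : ℂ → ℝ} (hf : g.IsRLip f) (z w : ℂ) : |f z - f w| ≤ g.rdist z w :=
  abs_sub_le_iff.2 ⟨by linarith [hf z w], by linarith [hf w z, g.rdist_comm z w]⟩

theorem IsShort.sub_const {f : ℂ → ℝ} (hf : g.IsShort f) (C : ℝ) : g.IsShort fun z => f z - C :=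
  ⟨hf.contDiff.sub contDiff_const, fun z v => by
    rw [fderiv_sub_const]; exact hf.abs_fderiv_le z v⟩

theorem IsRLip.exists_isShort_near {f : ℂ → ℝ} (hf : g.IsRLip f) {δ : ℝ} (hδ : 0 < δ) :
    ∃ F : ℂ → ℝ, g.IsShort F ∧ ∀ z, f z ≤ (1 + δ) * F z ∧ (1 + δ) * F z ≤ f z + 2 * δ := by
  obtain ⟨F, hF, hb, hn, -⟩ := hf.exists_contDiff hδ
  have h1 : 0 < 1 + δ := by linarith
  refine ⟨fun z => (1 + δ)⁻¹ * (F z + δ), ⟨contDiff_const.mul (hF.add contDiff_const),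
    fun z v => ?_⟩, fun z => ?_⟩
  · rw [fderiv_const_mul (((hF.differentiable (by simp)) z).add_const δ), fderiv_add_const,
      smul_apply, smul_eq_mul, abs_mul, abs_inv, abs_of_pos h1, inv_mul_le_iff₀ h1]
    exact hb z v
  · rw [mul_inv_cancel_left₀ h1.ne']
    have := abs_le.1 (hn z)
    constructor <;> linarith

/-- If two small sets of area at least `b` are mapped by `(f, h)` into the square of radius `ρ`
around the origin and around `(a, 0)`, respectively, then a function `u` cannot vary too much
from the first set to the second one. -/
theorem transport_inequality {f h u : ℂ → ℝ} (hf : g.IsShort f) (hh : g.IsShort h)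
    (hu : g.IsShort u) {a ρ ρ' K e m b τ : ℝ} (ha : 0 ≤ a) (hρ : 0 < ρ) (hρ' : ρ < ρ') {N : ℕ}
    (hl : ∀ y ∈ Set.Icc (-((N : ℝ) * 2)) (N * 2),
      f ((-(N * (2 * Real.pi)) : ℝ) + y * I) ≤ -ρ')
    (hr : ∀ y ∈ Set.Icc (-((N : ℝ) * 2)) (N * 2), a + ρ' ≤ f ((N * (2 * Real.pi) : ℝ) + y * I))
    (hb : ∀ x ∈ Set.Icc (-((N : ℝ) * (2 * Real.pi))) (N * (2 * Real.pi)),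
      h (x + (-(N * 2) : ℝ) * I) ≤ -ρ')
    (ht : ∀ x ∈ Set.Icc (-((N : ℝ) * (2 * Real.pi))) (N * (2 * Real.pi)),
      ρ' ≤ h (x + (N * 2 : ℝ) * I))
    (hτ : ∫ z in latticeRect N, (g.density z - jac f h z) = τ)
    (hu0 : ∀ z, 0 ≤ u z) (huK : ∀ z, u z ≤ K) {S T : Set ℂ} (hS : MeasurableSet S)
    (hT : MeasurableSet T) (hSR : S ⊆ latticeRect N) (hTR : T ⊆ latticeRect N)
    (hSf : ∀ z ∈ S, |f z| ≤ ρ) (hSh : ∀ z ∈ S, |h z| ≤ ρ) (hSu : ∀ z ∈ S, u z ≤ e)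
    (hTf : ∀ z ∈ T, |f z - a| ≤ ρ) (hTh : ∀ z ∈ T, |h z| ≤ ρ) (hTu : ∀ z ∈ T, m ≤ u z)
    (hm : 0 ≤ m) (heK : e ≤ K) (hSb : b ≤ ∫ z in S, g.density z)
    (hTb : b ≤ ∫ z in T, g.density z) :
    (m + K - e) * b ≤ (2 * ρ') ^ 2 * (K + a + 2 * ρ') + (2 * K + 2 * ρ') * τ := by
  have hn : (0 : ℝ) ≤ N := N.cast_nonneg
  have hab : -(N * (2 * Real.pi)) ≤ (N * (2 * Real.pi)) := by
    nlinarith [mul_nonneg hn Real.pi_pos.le]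
  have hcd : -((N : ℝ) * 2) ≤ N * 2 := by linarith
  let η : ContDiffBump (0 : ℝ) := ⟨ρ, ρ', hρ, hρ'⟩
  set ψ : ℝ → ℝ := fun x => η x with hψ
  have hψc : ContDiff ℝ ∞ ψ := η.contDiff
  have hψ0 (x) : 0 ≤ ψ x := η.nonneg
  have hψ1 (x) : ψ x ≤ 1 := η.le_one
  have hψone {x} (hx : |x| ≤ ρ) : ψ x = 1 := η.one_of_mem_closedBall (by simpa using hx)
  have hψzero {x} (hx : ρ' ≤ |x|) : ψ x = 0 := η.zero_of_le_dist (by simpa using hx)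
  have hψl : ∀ x ≤ -ρ', ψ x = 0 := fun x hx => hψzero (le_abs.2 (.inr (by linarith)))
  have hψr : ∀ x, ρ' ≤ x → ψ x = 0 := fun x hx => hψzero (le_abs.2 (.inl hx))
  obtain ⟨P, k, hP, dP, hPl, hPr, hPk, hk⟩ :=
    exists_primitive hψc (show -ρ' ≤ ρ' by linarith) hψ0 hψ1 hψl hψr
  have hPm : Monotone P := monotone_of_deriv_nonneg (fun x => (dP x).differentiableAt)
    fun x => by rw [(dP x).deriv]; exact hψ0 x
  have hk0 : 0 ≤ k := (hPk 0).1.trans (hPk 0).2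
  -- Its derivative is the bump at 0 minus the bump at a, so the transport formula compares u near
  -- the two squares; Φ itself weights the strip between them.
  set Φ : ℝ → ℝ := fun x => P x - P (x - a) with hΦ
  have hΦc : ContDiff ℝ ∞ Φ := hP.sub (hP.comp (contDiff_id.sub contDiff_const))
  have dΦ (x) : HasDerivAt Φ (ψ x - ψ (x - a)) x := (dP x).sub ((dP (x - a)).comp_sub_const x a)
  have hΦ0 (x) : 0 ≤ Φ x := sub_nonneg.2 (hPm (by linarith))
  have hΦk (x) : Φ x ≤ k := by linarith [(hPk x).2, (hPk (x - a)).1]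
  have hΦl : ∀ x ≤ -ρ', Φ x = 0 := fun x hx => by
    simp [hΦ, hPl x hx, hPl (x - a) (by linarith)]
  have hΦr : ∀ x, a + ρ' ≤ x → Φ x = 0 := fun x hx => by
    simp [hΦ, hPr x (by linarith), hPr (x - a) (by linarith)]
  obtain ⟨P₂, k₂, hP₂, dP₂, hP₂l, hP₂r, hP₂k, hk₂⟩ :=
    exists_primitive hΦc (show -ρ' ≤ a + ρ' by linarith) hΦ0 hΦk hΦl hΦr
  -- the two pullback formulas and the transport formula
  have G₁ : ∫ z in latticeRect N, ψ (f z) * ψ (h z) * jac f h z = k * k :=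
    integral_mul_mul_jac hf.contDiff hh.contDiff hP hP dP dP hPl hPr hPl hPr hψl hψr hab hcd
      hl (fun y hy => by linarith [hr y hy]) hb ht
  have G₂ : ∫ z in latticeRect N, Φ (f z) * ψ (h z) * jac f h z = k₂ * k :=
    integral_mul_mul_jac hf.contDiff hh.contDiff hP₂ hP dP₂ dP hP₂l hP₂r hPl hPr hψl hψr hab hcd
      hl hr hb ht
  have G₃ := integral_transport_jac hf.contDiff hh.contDiff hu.contDiff hΦc hP dΦ dP hΦl hΦr
    hψl hψr hab hcd hl hr hb ht
  change ∫ z in latticeRect N, _ = 0 at G₃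
  have cf := hf.contDiff.continuous
  have ch := hh.contDiff.continuous
  have cu := hu.contDiff.continuous
  have cψ := hψc.continuous
  have cΦ := hΦc.continuous
  have cν := g.continuous_density
  have cj := continuous_jac hf.contDiff hh.contDiff
  have cj' := continuous_jac hu.contDiff hh.contDiff
  have int {q : ℂ → ℝ} (hq : Continuous q) : IntegrableOn q (latticeRect N) :=
    hq.continuousOn.integrableOn_compact (isCompact_latticeRect N)
  have hRm : MeasurableSet (latticeRect N) := (isCompact_latticeRect N).measurableSet
  have indS : ∫ z in latticeRect N, S.indicator g.density z = ∫ z in S, g.density z := by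
    rw [setIntegral_indicator hS, Set.inter_eq_self_of_subset_right hSR]
  have indT : ∫ z in latticeRect N, T.indicator g.density z = ∫ z in T, g.density z := by
    rw [setIntegral_indicator hT, Set.inter_eq_self_of_subset_right hTR]
  -- A pointwise inequality. On T the function u is at least m, on S the function K - u is at least
  -- K - e, and elsewhere both are only known to be nonnegative. Replacing density by Jacobian costs
  -- K twice and `k` once, times their difference, whose integral is τ.
  have key : ∫ z in latticeRect N, (m * T.indicator g.density z
        + (K - e) * S.indicator g.density z) ≤
      ∫ z in latticeRect N, (K * (ψ (f z) * ψ (h z) * jac f h z) + Φ (f z) * ψ (h z) * jac f h z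
        + (2 * K + k) * (g.density z - jac f h z)
        - (Φ (f z) * ψ (h z) * jac u h z
          + u z * ((ψ (f z) - ψ (f z - a)) * ψ (h z)) * jac f h z)) := by
    refine integral_mono ?_ (int (by fun_prop)) fun z => ?_
    · exact (((int cν).indicator hT).const_mul m).add (((int cν).indicator hS).const_mul (K - e))
    · have j₁ := (abs_le.1 (hf.abs_jac_le hh z)).2
      have j₂ := (abs_le.1 (hu.abs_jac_le hh z)).2
      have ν0 := (g.density_pos z).le
      set ν := g.density z
      set J := jac f h z
      have hJ : 0 ≤ ν - J := by linarith
      have x0 : 0 ≤ ψ (f z) * ψ (h z) := mul_nonneg (hψ0 _) (hψ0 _)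
      have x1 : ψ (f z) * ψ (h z) ≤ 1 := mul_le_one₀ (hψ1 _) (hψ0 _) (hψ1 _)
      have y0 : 0 ≤ ψ (f z - a) * ψ (h z) := mul_nonneg (hψ0 _) (hψ0 _)
      have y1 : ψ (f z - a) * ψ (h z) ≤ 1 := mul_le_one₀ (hψ1 _) (hψ0 _) (hψ1 _)
      have w0 : 0 ≤ Φ (f z) * ψ (h z) := mul_nonneg (hΦ0 _) (hψ0 _)
      have w1 : Φ (f z) * ψ (h z) ≤ k :=
        (mul_le_of_le_one_right (hΦ0 _) (hψ1 _)).trans (hΦk _)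
      have eT : m * T.indicator g.density z ≤ u z * (ψ (f z - a) * ψ (h z)) * ν := by
        by_cases hz : z ∈ T
        · rw [Set.indicator_of_mem hz, hψone (hTf z hz), hψone (hTh z hz)]
          have := mul_le_mul_of_nonneg_right (hTu z hz) ν0
          linarith
        · rw [Set.indicator_of_notMem hz, mul_zero]
          exact mul_nonneg (mul_nonneg (hu0 z) y0) ν0
      have eS : (K - e) * S.indicator g.density z ≤ (K - u z) * (ψ (f z) * ψ (h z)) * ν := by
        by_cases hz : z ∈ S
        · rw [Set.indicator_of_mem hz, hψone (hSf z hz), hψone (hSh z hz)]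
          have := mul_le_mul_of_nonneg_right (hSu z hz) ν0
          linarith
        · rw [Set.indicator_of_notMem hz, mul_zero]
          exact mul_nonneg (mul_nonneg (sub_nonneg.2 (huK z)) x0) ν0
      have r₁ : u z * (ψ (f z - a) * ψ (h z)) * (ν - J) ≤ K * (ν - J) :=
        mul_le_mul_of_nonneg_right ((mul_le_of_le_one_right (hu0 z) y1).trans (huK z)) hJ
      have r₂ : (K - u z) * (ψ (f z) * ψ (h z)) * (ν - J) ≤ K * (ν - J) :=
        mul_le_mul_of_nonneg_right ((mul_le_of_le_one_right (sub_nonneg.2 (huK z)) x1).trans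
          (by linarith [hu0 z])) hJ
      have r₃ : Φ (f z) * ψ (h z) * (ν - J) ≤ k * (ν - J) := mul_le_mul_of_nonneg_right w1 hJ
      have r₄ : Φ (f z) * ψ (h z) * jac u h z ≤ Φ (f z) * ψ (h z) * ν :=
        mul_le_mul_of_nonneg_left j₂ w0
      linarith
  rw [integral_add (((int cν).indicator hT).const_mul m) (((int cν).indicator hS).const_mul (K - e)),
    integral_const_mul, integral_const_mul, indS, indT,
    integral_sub (int (by fun_prop)) (int (by fun_prop)), G₃,
    integral_add (int (by fun_prop)) (int (by fun_prop)),
    integral_add (int (by fun_prop)) (int (by fun_prop)), integral_const_mul, integral_const_mul,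
    G₁, G₂, hτ] at key
  have hτ0 : 0 ≤ τ := by
    rw [← hτ]
    exact integral_nonneg fun z => sub_nonneg.2 (abs_le.1 (hf.abs_jac_le hh z)).2
  have hK : 0 ≤ K := (hu0 0).trans (huK 0)
  have b₁ := mul_le_mul_of_nonneg_left hTb hm
  have b₂ := mul_le_mul_of_nonneg_left hSb (sub_nonneg.2 heK)
  have hk' : k ≤ 2 * ρ' := by linarith
  have hk₂' : k₂ ≤ 2 * ρ' * (a + 2 * ρ') :=
    hk₂.trans ((mul_le_mul_of_nonneg_right hk' (by linarith)).trans_eq (by ring))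
  have c₁ : k * k ≤ (2 * ρ') ^ 2 := by nlinarith
  have c₂ : k₂ * k ≤ 2 * ρ' * (a + 2 * ρ') * (2 * ρ') :=
    mul_le_mul hk₂' hk' hk0 (by nlinarith)
  have c₃ := mul_le_mul_of_nonneg_left c₁ hK
  have c₄ := mul_le_mul_of_nonneg_right hk' hτ0
  linarith

end KleinMetric

end

/-! ### Small discs, and bounds uniform in the calibration. -/

noncomputable section

open MeasureTheory Complex

namespace KleinMetric

variable (g : KleinMetric)

/-- An orthonormal coframe. -/
theorem exists_coframe (z : ℂ) : ∃ α β : ℂ →L[ℝ] ℝ, α 1 * β I - α I * β 1 = g.density z ∧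
    ∀ v, α v ^ 2 + β v ^ 2 = g.form z v v := by
  set E := g.form z 1 1 with hE
  set F := g.form z 1 I with hF
  set G := g.form z I I with hG
  have hE0 : 0 < E := g.pos z 1 one_ne_zero
  have hdet : 0 < E * G - F ^ 2 := g.det_pos z
  have hs : √E ^ 2 = E := Real.sq_sqrt hE0.le
  have hs0 : 0 < √E := Real.sqrt_pos.2 hE0
  have hd : √(E * G - F ^ 2) ^ 2 = E * G - F ^ 2 := Real.sq_sqrt hdet.le
  refine ⟨√E • reCLM + (F / √E) • imCLM, (√(E * G - F ^ 2) / √E) • imCLM, ?_, fun v => ?_⟩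
  · simp only [density, ← hE, ← hF, ← hG, add_apply, smul_apply, reCLM_apply, imCLM_apply, one_re,
      one_im, I_re, I_im, smul_eq_mul]
    field_simp
    simp
  · rw [form_apply, ← hE, ← hF, ← hG]
    simp only [add_apply, smul_apply, reCLM_apply, imCLM_apply, smul_eq_mul]
    field_simp
    rw [hd, hs]
    ring

/-- The ball of radius `r` around `z` for the Euclidean metric `g.form z`. -/
def ellipse (z : ℂ) (r : ℝ) : Set ℂ := {w | g.speed z (w - z) < r}

theorem measurableSet_ellipse (z : ℂ) (r : ℝ) : MeasurableSet (g.ellipse z r) := by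
  refine IsOpen.measurableSet (isOpen_lt ?_ continuous_const)
  fun_prop

theorem density_le_of_speed_le {z w : ℂ} {c : ℝ} (hc : 0 < c)
    (h : ∀ v, g.speed z v ≤ c * g.speed w v) : g.density z ≤ c ^ 2 * g.density w := by
  obtain ⟨α, β, hw, hq⟩ := g.exists_coframe z
  have ha (v) : |α v| ≤ g.speed z v :=
    Real.abs_le_sqrt (by rw [← hq]; linarith [sq_nonneg (β v)])
  have hb (v) : |β v| ≤ g.speed z v :=
    Real.abs_le_sqrt (by rw [← hq]; linarith [sq_nonneg (α v)])
  have key := g.abs_wedge_le_density (z := w) (α := c⁻¹ • α) (β := c⁻¹ • β)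
    (fun v => by
      rw [smul_apply, smul_eq_mul, abs_mul, abs_inv, abs_of_pos hc, inv_mul_le_iff₀ hc]
      exact (ha v).trans (h v))
    (fun v => by
      rw [smul_apply, smul_eq_mul, abs_mul, abs_inv, abs_of_pos hc, inv_mul_le_iff₀ hc]
      exact (hb v).trans (h v))
  simp only [smul_apply, smul_eq_mul] at key
  rw [show c⁻¹ * α 1 * (c⁻¹ * β I) - c⁻¹ * α I * (c⁻¹ * β 1) =
    (c ^ 2)⁻¹ * (α 1 * β I - α I * β 1) by ring, hw, abs_of_nonneg
    (mul_nonneg (by positivity) (g.density_pos z).le), inv_mul_le_iff₀ (by positivity)] at key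
  exact key

/-- An orthonormal coframe maps the ellipse onto a round disc, with determinant equal to the
density. -/
theorem volume_ellipse (z : ℂ) {r : ℝ} (hr : 0 ≤ r) :
    volume (g.ellipse z r) = ENNReal.ofReal (Real.pi * r ^ 2 / g.density z) := by
  obtain ⟨α, β, hw, hq⟩ := g.exists_coframe z
  let S : ℂ →ₗ[ℝ] ℂ := (α : ℂ →ₗ[ℝ] ℝ).smulRight 1 + (β : ℂ →ₗ[ℝ] ℝ).smulRight I
  have hS (v) : S v = α v + β v * I := by simp [S]
  have hdet : LinearMap.det S = g.density z := by
    rw [← LinearMap.det_toMatrix basisOneI, Matrix.det_fin_two]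
    simp only [LinearMap.toMatrix_apply, coe_basisOneI, coe_basisOneI_repr, hS]
    simp [← hw]
  have hnorm (v) : ‖S v‖ = g.speed z v := by
    rw [hS, norm_add_mul_I, hq, speed]
  have hset : g.ellipse z r = (fun w => w + -z) ⁻¹' (S ⁻¹' Metric.ball 0 r) := by
    ext w
    simp [ellipse, ← hnorm, sub_eq_add_neg]
  have hd := g.density_pos z
  rw [hset, measure_preimage_add_right, Measure.addHaar_preimage_linearMap _
    (by rw [hdet]; exact hd.ne'), hdet, abs_of_pos (inv_pos.2 hd), volume_ball,
    show Real.pi * r ^ 2 / g.density z = (g.density z)⁻¹ * (r ^ 2 * Real.pi) by ring,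
    ENNReal.ofReal_mul (inv_pos.2 hd).le, ENNReal.ofReal_mul (sq_nonneg r), ENNReal.ofReal_pow hr]
  congr 2
  rw [← NNReal.coe_real_pi, ENNReal.ofReal_coe_nnreal]

theorem exists_ellipse_bounds {δ : ℝ} (hδ : 0 < δ) {ε : ℝ} (hε : 0 < ε) :
    ∃ r₀ > 0, ∀ z r, 0 < r → r < r₀ →
      (∀ w ∈ g.ellipse z r, g.rdist z w ≤ (1 + δ) * r ∧ ‖w - z‖ < ε) ∧
      Real.pi * r ^ 2 / (1 + δ) ^ 2 ≤ ∫ w in g.ellipse z r, g.density w := by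
  obtain ⟨m, hm, hmv⟩ := g.exists_le_speed
  obtain ⟨ε₁, hε₁, hsp⟩ := g.exists_speed_le_one_add_mul hδ
  refine ⟨m * min ε ε₁, by positivity, fun z r hr hr₀ => ?_⟩
  have hnear {w} (hw : w ∈ g.ellipse z r) : ‖w - z‖ < min ε ε₁ :=
    lt_of_mul_lt_mul_left (((hmv z (w - z)).trans_lt hw).trans hr₀) hm.le
  refine ⟨fun w hw => ⟨?_, (hnear hw).trans_le (min_le_left _ _)⟩, ?_⟩
  · have := g.rdist_le_of_speed_le (z := z) (v := w - z) (M := (1 + δ) * r) fun s hs => by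
      refine (hsp z _ _ ?_).trans (mul_le_mul_of_nonneg_left (le_of_lt hw) (by linarith))
      rw [dist_eq_norm, add_sub_cancel_left, norm_mul, norm_real, Real.norm_eq_abs,
        abs_of_nonneg hs.1]
      have := (hnear hw).trans_le (min_le_right _ _)
      nlinarith [norm_nonneg (w - z), hs.2]
    simpa using this
  · have hν := g.density_pos z
    have hvol := g.volume_ellipse z hr.le
    have hbdd : Bornology.IsBounded (g.ellipse z r) := by
      refine (Metric.isBounded_ball (x := z) (r := min ε ε₁)).subset fun w hw => ?_
      rw [Metric.mem_ball, dist_eq_norm]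
      exact hnear hw
    have hi : IntegrableOn g.density (g.ellipse z r) :=
      (g.continuous_density.continuousOn.integrableOn_compact hbdd.isCompact_closure).mono_set
        subset_closure
    have := setIntegral_mono_on (f := fun _ => g.density z / (1 + δ) ^ 2)
      (integrableOn_const (by rw [hvol]; exact ENNReal.ofReal_ne_top)) hi
      (g.measurableSet_ellipse z r) fun w hw => by
        rw [div_le_iff₀' (by positivity)]
        refine g.density_le_of_speed_le (by linarith) fun v => hsp _ _ _ ?_
        rw [dist_comm, dist_eq_norm]
        exact (hnear hw).trans_le (min_le_right _ _)
    rw [setIntegral_const, Measure.real, hvol, ENNReal.toReal_ofReal (by positivity),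
      smul_eq_mul] at this
    refine le_of_eq_of_le ?_ this
    field_simp

/-- The bound does not depend on f, so the size of the rectangle can be fixed before θ and the
calibrations are chosen. -/
theorem exists_norm_bound : ∃ D > 0, ∀ f, g.IsShort f → ∀ x ∈ Set.Icc 0 Real.pi, ∀ w ∈ latticeBox,
    |f w - f (x : ℂ)| ≤ D := by
  obtain ⟨M, hM, h⟩ := g.exists_speed_le
  refine ⟨M * 12, by positivity, fun f hf x hx w hw => ?_⟩
  refine (hf.isRLip.abs_sub_le _ _).trans ?_
  have h1 := g.rdist_le_of_speed_le (z := w) (v := x - w) (fun s _ => h _ _)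
  rw [add_sub_cancel] at h1
  refine h1.trans (mul_le_mul_of_nonneg_left ?_ hM.le)
  refine (norm_le_abs_re_add_abs_im _).trans ?_
  have h2 := hw.1
  have h3 := hw.2
  simp only [Set.mem_preimage, Set.mem_Icc] at h2 h3
  have h4 := Real.pi_lt_four
  have : |((x : ℂ) - w).re| ≤ 8 := abs_le.2 (by
    simp only [sub_re, ofReal_re]; constructor <;> linarith [hx.1, hx.2])
  have : |((x : ℂ) - w).im| ≤ 2 := abs_le.2 (by
    simp only [sub_im, ofReal_im]; constructor <;> linarith)
  linarith

end KleinMetric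

theorem add_latticeVec_eq {f : ℂ → ℝ} {A B : ℝ} (h₁ : ∀ z, f (z + 2 * Real.pi) = f z + A)
    (h₂ : ∀ z, f (z + 2 * I) = f z + B) (a b : ℤ) (z : ℂ) :
    f (z + latticeVec a b) = f z + (a * A + b * B) := by
  have key {τ : ℂ} {C : ℝ} (h : ∀ z, f (z + τ) = f z + C) (n : ℤ) (z : ℂ) :
      f (z + n * τ) = f z + n * C := by
    obtain ⟨n, rfl | rfl⟩ := n.eq_nat_or_neg
    · simpa using add_natCast_mul_period h n z
    · have := add_natCast_mul_period h n (z + -n * τ)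
      rw [neg_mul, neg_add_cancel_right] at this
      push_cast
      rw [neg_mul]
      linarith
  rw [latticeVec, ← add_assoc, key h₂, key h₁]
  ring

end

/-! ### Equality is never attained. -/

noncomputable section

open MeasureTheory Complex

theorem abs_sub_le_of_horizontal_period {f : ℂ → ℝ} {A D : ℝ}
    (h₁ : ∀ z, f (z + 2 * Real.pi) = f z + A) (h₂ : ∀ z, f (z + 2 * I) = f z)
    (hD : ∀ w ∈ latticeBox, |f w| ≤ D) (n : ℤ) (y : ℝ) :
    |f ((n * (2 * Real.pi) : ℝ) + y * I) - n * A| ≤ D := by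
  obtain ⟨b, hb, -⟩ := existsUnique_add_zsmul_mem_Ico (zero_lt_two (α := ℝ)) y 0
  have hw : ((y + b • 2 : ℝ) : ℂ) * I ∈ latticeBox := by
    refine ⟨?_, ?_⟩
    · simpa using Real.pi_pos.le
    · simpa using Set.Ico_subset_Icc_self hb
  have := add_latticeVec_eq (B := 0) h₁ (by simpa using h₂) n (-b) (((y + b • 2 : ℝ) : ℂ) * I)
  have e : (((n * (2 * Real.pi) : ℝ) : ℂ) + y * I) =
      ((y + b • 2 : ℝ) : ℂ) * I + latticeVec n (-b) := by
    simp [latticeVec]; ring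
  rw [e, this]
  simpa using hD _ hw

theorem abs_sub_le_of_vertical_period {f : ℂ → ℝ} {B D : ℝ}
    (h₁ : ∀ z, f (z + 2 * Real.pi) = f z) (h₂ : ∀ z, f (z + 2 * I) = f z + B)
    (hD : ∀ w ∈ latticeBox, |f w| ≤ D) (n : ℤ) (x : ℝ) :
    |f (x + (n * 2 : ℝ) * I) - n * B| ≤ D := by
  obtain ⟨a, ha, -⟩ := existsUnique_add_zsmul_mem_Ico Real.two_pi_pos x 0
  have hw : ((x + a • (2 * Real.pi) : ℝ) : ℂ) ∈ latticeBox := by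
    refine ⟨?_, ?_⟩
    · simpa using Set.Ico_subset_Icc_self ha
    · simp
  have := add_latticeVec_eq (A := 0) (by simpa using h₁) h₂ (-a) n
    ((x + a • (2 * Real.pi) : ℝ) : ℂ)
  have e : ((x : ℂ) + (n * 2 : ℝ) * I) =
      ((x + a • (2 * Real.pi) : ℝ) : ℂ) + latticeVec (-a) n := by
    simp [latticeVec]; ring
  rw [e, this]
  simpa using hD _ hw

theorem mem_latticeRect_of_norm_sub_lt {N : ℕ} (hN : 2 ≤ N) {x : ℝ}
    (hx : x ∈ Set.Icc 0 (2 * Real.pi)) {w : ℂ} (hw : ‖w - x‖ < 1) : w ∈ latticeRect N := by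
  have h1 := abs_lt.1 ((abs_re_le_norm _).trans_lt hw)
  have h2 := abs_lt.1 ((abs_im_le_norm _).trans_lt hw)
  simp only [sub_re, sub_im, ofReal_re, ofReal_im, sub_zero] at h1 h2
  have hN' : (2 : ℝ) ≤ N := by exact_mod_cast hN
  have h3 := Real.pi_gt_three
  have h4 : 2 * (2 * Real.pi) ≤ N * (2 * Real.pi) :=
    mul_le_mul_of_nonneg_right hN' (by linarith)
  refine ⟨⟨?_, ?_⟩, ?_, ?_⟩ <;> linarith [hx.1, hx.2]

namespace KleinMetric

variable (g : KleinMetric)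

/-- Since σ maps 0 to π, the values at the two ends are opposite. -/
theorem exists_real_zero {h : ℂ → ℝ} (hc : Continuous h) (hσ : ∀ z, h (glide z) = -h z) :
    ∃ x ∈ Set.Icc 0 Real.pi, h (x : ℂ) = 0 := by
  have hcx : Continuous fun x : ℝ => h x := by fun_prop
  have h1 : h ((Real.pi : ℝ) : ℂ) = -h ((0 : ℝ) : ℂ) := by
    rw [← hσ]; simp [glide]
  have := intermediate_value_uIcc (a := 0) (b := Real.pi) (f := fun x : ℝ => h x)
    hcx.continuousOn
  rw [Set.uIcc_of_le Real.pi_pos.le] at this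
  refine this ?_
  simp only [h1, Set.mem_uIcc]
  rcases le_total (h ((0 : ℝ) : ℂ)) 0 with h0 | h0
  · exact .inl ⟨h0, by linarith⟩
  · exact .inr ⟨by linarith, h0⟩

theorem integral_density_sub_jac {f h : ℂ → ℝ} (hf : ContDiff ℝ ∞ f) (hh : ContDiff ℝ ∞ h)
    {L l θ : ℝ} (heq : L * l = 2 * g.vol) (f₁ : ∀ z, f (z + 2 * Real.pi) = f z + θ * L)
    (f₂ : ∀ z, f (z + 2 * I) = f z) (h₁ : ∀ z, h (z + 2 * Real.pi) = h z)
    (h₂ : ∀ z, h (z + 2 * I) = h z + θ * l) (N : ℕ) :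
    ∫ z in latticeRect N, (g.density z - jac f h z) = 4 * N ^ 2 * (L * l) * (1 - θ ^ 2) := by
  rw [integral_sub (g.continuous_density.continuousOn.integrableOn_compact
      (isCompact_latticeRect N))
    ((continuous_jac hf hh).continuousOn.integrableOn_compact
      (isCompact_latticeRect N)), g.integral_density_latticeRect,
    integral_jac_of_periods hf hh f₁ f₂ h₁ h₂]
  linear_combination -4 * (N : ℝ) ^ 2 * heq

theorem exists_scale {C c : ℝ} (hc : 0 < c) :
    ∃ θ : ℝ, 1 / 2 < θ ∧ θ < 1 ∧ C * (1 - θ ^ 2) < c := by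
  have hlim : Filter.Tendsto (fun θ : ℝ => C * (1 - θ ^ 2)) (nhdsWithin 1 (Set.Iio 1)) (nhds 0) :=
    (Continuous.tendsto' (by fun_prop) _ _ (by simp)).mono_left nhdsWithin_le_nhds
  have h1 : ∀ᶠ θ in nhdsWithin 1 (Set.Iio 1), θ ∈ Set.Ioo (1 / 2 : ℝ) 1 :=
    Ioo_mem_nhdsLT (by norm_num)
  obtain ⟨θ, ⟨h0, h1⟩, h2⟩ := (h1.and (hlim.eventually_lt_const hc)).exists
  exact ⟨θ, h0, h1, h2⟩

set_option maxHeartbeats 1000000 in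
/-- There are no almost isometric calibrations of a metric for which the glide reflection moves
every point by at least the horizontal period. -/
theorem not_calibrated {L l : ℝ} (hL : 0 < L) (hl : 0 < l) (heq : L * l = 2 * g.vol)
    (hLd : ∀ z, L ≤ g.rdist z (glide z))
    (hhor : ∀ θ, 0 < θ → θ < 1 →
      ∃ f : ℂ → ℝ, g.IsShort f ∧ (∀ z, f (z + 2 * Real.pi) = f z + θ * L) ∧
        (∀ z, f (z + 2 * I) = f z) ∧ ∀ z, f (glide z) = f z + θ * L / 2)
    (hver : ∀ θ, 0 < θ → θ < 1 →
      ∃ f : ℂ → ℝ, g.IsShort f ∧ (∀ z, f (z + 2 * Real.pi) = f z) ∧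
        (∀ z, f (z + 2 * I) = f z + θ * l) ∧ ∀ z, f (glide z) = -f z) : False := by
  obtain ⟨D, hD, hDb⟩ := g.exists_norm_bound
  obtain ⟨r₀, hr₀, hell⟩ := g.exists_ellipse_bounds (δ := 1 / 1000) (by norm_num) one_pos
  -- Large enough that the boundary of the rectangle is mapped outside the strip for every θ > 1/2,
  -- whence the factor 2. The spare period on the right makes room for the shift θL/2.
  obtain ⟨N, hN⟩ := exists_nat_gt (2 * (D + 1) / L + 2 * (D + 1) / l + 2)
  have q₁ : 0 < 2 * (D + 1) / L := by positivity
  have q₂ : 0 < 2 * (D + 1) / l := by positivity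
  have hN2 : (2 : ℝ) ≤ N := by linarith
  have hNL : 2 * (D + 1) ≤ (N - 1) * L := (div_le_iff₀ hL).1 (by linarith)
  have hNl : 2 * (D + 1) ≤ N * l := (div_le_iff₀ hl).1 (by linarith)
  set ρ := min (1 / 1000) (min (L / 1000) (r₀ / 2)) with hρdef
  have hρ : 0 < ρ := by positivity
  have hρ1 : ρ ≤ 1 / 1000 := min_le_left _ _
  have hρL : ρ ≤ L / 1000 := (min_le_right _ _).trans (min_le_left _ _)
  have hρr : ρ ≤ r₀ / 2 := (min_le_right _ _).trans (min_le_right _ _)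
  -- θ comes after N and ρ, so that the whole area defect in the transport inequality is below 0.01
  -- L ρ².
  obtain ⟨θ, hθ0, hθ1, hθ⟩ := exists_scale (C := (2 * (L + 2 * ρ) + 2 * (1.01 * ρ)) *
    (4 * N ^ 2 * (L * l))) (c := 0.01 * L * ρ ^ 2) (by positivity)
  have hθp : 0 < θ := by linarith
  obtain ⟨f₀, hf₀, f₁, f₂, fσ⟩ := hhor θ hθp hθ1
  obtain ⟨h, hh, h₁, h₂, hσ⟩ := hver θ hθp hθ1
  obtain ⟨x, hx, hx0⟩ := exists_real_zero hh.contDiff.continuous hσ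
  set f : ℂ → ℝ := fun z => f₀ z - f₀ x with hfdef
  have hf : g.IsShort f := hf₀.sub_const _
  have hfx : f x = 0 := sub_self _
  have f₁' (z) : f (z + 2 * Real.pi) = f z + θ * L := by simp only [hfdef, f₁]; ring
  have f₂' (z) : f (z + 2 * I) = f z := by simp only [hfdef, f₂]
  have hgx : glide x = ((x + Real.pi : ℝ) : ℂ) := by simp [glide]
  have hfσ : f (glide x) = θ * L / 2 := by simp only [hfdef, fσ]; ring
  have hhσ : h (glide x) = 0 := by rw [hσ, hx0, neg_zero]
  have hfD : ∀ w ∈ latticeBox, |f w| ≤ D := fun w hw => by simpa [hfx] using hDb f hf x hx w hw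
  have hhD : ∀ w ∈ latticeBox, |h w| ≤ D := fun w hw => by simpa [hx0] using hDb h hh x hx w hw
  have fside := abs_sub_le_of_horizontal_period f₁' f₂' hfD
  have hside := abs_sub_le_of_vertical_period h₁ h₂ hhD
  have hθL : L / 2 ≤ θ * L := by nlinarith
  have hθl : l / 2 ≤ θ * l := by nlinarith
  have eA : D + 1 ≤ (N - 1) * (θ * L) := by nlinarith
  have eB : D + 1 ≤ N * (θ * l) := by nlinarith
  -- the test function
  obtain ⟨u, hu, huv⟩ := ((isRLip_rdist (g := g) x).min_const L).exists_isShort_near hρ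
  have hu0 (z) : 0 ≤ u z := by
    have : 0 ≤ (1 + ρ) * u z := (le_min (g.rdist_nonneg z x) hL.le).trans (huv z).1
    exact nonneg_of_mul_nonneg_right this (by linarith)
  have hu_le (z) : u z ≤ (1 + ρ) * u z := by nlinarith [hu0 z]
  set r := ρ / (1 + 1 / 1000) with hr
  have hrρ : (1 + 1 / 1000) * r = ρ := by rw [hr]; field_simp
  have hr0 : 0 < r := by positivity
  have hrr : r < r₀ := by linarith
  have ell₁ := hell x r hr0 hrr
  have ell₂ := hell (glide x) r hr0 hrr
  have harea : 3.1 * ρ ^ 2 ≤ Real.pi * r ^ 2 / (1 + 1 / 1000) ^ 2 := by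
    rw [le_div_iff₀ (by norm_num), ← hrρ]
    nlinarith [Real.pi_gt_d2, sq_nonneg r, mul_le_mul_of_nonneg_right Real.pi_gt_d2.le (sq_nonneg r)]
  have htau := g.integral_density_sub_jac hf.contDiff hh.contDiff heq f₁' f₂' h₁ h₂ N
  have main := transport_inequality hf hh hu (a := θ * L / 2) (ρ := ρ) (ρ' := 1.01 * ρ)
    (K := L + 2 * ρ) (e := 3 * ρ) (m := L - ρ - L * ρ) (b := 3.1 * ρ ^ 2) (N := N)
    (by positivity) hρ (by linarith)
    (fun y _ => by
      have := (abs_le.1 (fside (-N) y)).2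
      push_cast at this ⊢
      rw [neg_mul] at this
      linarith)
    (fun y _ => by
      have := (abs_le.1 (fside N y)).1
      push_cast at this ⊢
      linarith)
    (fun y _ => by
      have := (abs_le.1 (hside (-N) y)).2
      push_cast at this ⊢
      rw [neg_mul] at this
      linarith)
    (fun y _ => by
      have := (abs_le.1 (hside N y)).1
      push_cast at this ⊢
      linarith)
    htau hu0
    (fun z => (hu_le z).trans ((huv z).2.trans (by linarith [min_le_right (g.rdist z x) L])))
    (S := g.ellipse x r) (T := g.ellipse (glide x) r) (g.measurableSet_ellipse _ _)
    (g.measurableSet_ellipse _ _)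
    (fun w hw => mem_latticeRect_of_norm_sub_lt (by exact_mod_cast hN2)
      ⟨hx.1, by linarith [hx.2, Real.pi_pos]⟩ (ell₁.1 w hw).2)
    (fun w hw => mem_latticeRect_of_norm_sub_lt (x := x + Real.pi) (by exact_mod_cast hN2)
      ⟨by linarith [hx.1, Real.pi_pos], by linarith [hx.2]⟩ (by
        have := (ell₂.1 w hw).2
        rwa [hgx] at this))
    (fun w hw => by
      have h1 := hf.isRLip.abs_sub_le x w
      rw [hfx, zero_sub, abs_neg] at h1
      exact h1.trans ((ell₁.1 w hw).1.trans hrρ.le))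
    (fun w hw => by
      have h1 := hh.isRLip.abs_sub_le x w
      rw [hx0, zero_sub, abs_neg] at h1
      exact h1.trans ((ell₁.1 w hw).1.trans hrρ.le))
    (fun w hw => by
      have h1 := (ell₁.1 w hw).1
      rw [hrρ, g.rdist_comm] at h1
      linarith [hu_le w, (huv w).2, min_le_left (g.rdist w x) L])
    (fun w hw => by
      have h1 := hf.isRLip.abs_sub_le (glide x) w
      rw [hfσ, abs_sub_comm] at h1
      exact h1.trans ((ell₂.1 w hw).1.trans hrρ.le))
    (fun w hw => by
      have h1 := hh.isRLip.abs_sub_le (glide x) w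
      rw [hhσ, zero_sub, abs_neg] at h1
      exact h1.trans ((ell₂.1 w hw).1.trans hrρ.le))
    (fun w hw => by
      have h1 := (ell₂.1 w hw).1
      rw [hrρ, g.rdist_comm] at h1
      have h2 := g.rdist_triangle x w (glide x)
      rw [g.rdist_comm x w] at h2
      have h3 : L - ρ ≤ (1 + ρ) * u w :=
        (le_min (by linarith [hLd x]) (by linarith)).trans (huv w).1
      have h4 : (1 + ρ) * (L - ρ - L * ρ) ≤ (1 + ρ) * u w := by
        nlinarith [mul_pos hL hρ, mul_pos (mul_pos hL hρ) hρ]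
      exact le_of_mul_le_mul_left h4 (by linarith))
    (by nlinarith) (by linarith) (harea.trans ell₁.2) (harea.trans ell₂.2)
  -- The leading coefficients of L are 6.2 on the left and about 6.13 on the right; the gap absorbs
  -- all terms in ρ.
  have hfin : 3.1 * (2 * L - 2 * ρ - L * ρ) ≤
      4 * 1.0201 * (L + 2 * ρ + θ * L / 2 + 2 * (1.01 * ρ)) + 0.01 * L := by
    refine le_of_mul_le_mul_right ?_ (pow_pos hρ 2)
    linarith
  nlinarith [mul_le_mul_of_nonneg_left hρ1 hL.le, mul_lt_mul_of_pos_right hθ1 hL]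

theorem Lσ_mul_lv_ne : g.Lσ * g.lv ≠ 2 * g.vol := by
  intro heq
  have hprod : 0 < g.Lσ * g.lv := by rw [heq]; linarith [g.vol_pos]
  exact g.not_calibrated (pos_of_mul_pos_left hprod g.lv_nonneg)
    (pos_of_mul_pos_right hprod g.Lσ_nonneg) heq g.Lσ_le_rdist_glide
    (fun _ h0 h1 => g.exists_horizontal h0 h1) (fun _ h0 h1 => g.exists_vertical h0 h1)

end KleinMetric

end

/-! ### The test metrics, and optimality of the constant. -/

noncomputable section

open MeasureTheory Complex

/-- The width function of the test metrics: close to `2` near the integers, and to `1` away from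
them. -/
def testWidth (n : ℕ) (y : ℝ) : ℝ := 1 + (Real.cos (Real.pi * y) ^ 2) ^ n

theorem one_le_testWidth (n : ℕ) (y : ℝ) : 1 ≤ testWidth n y :=
  le_add_of_nonneg_right (by positivity)

theorem testWidth_neg (n : ℕ) (y : ℝ) : testWidth n (-y) = testWidth n y := by
  simp [testWidth]

theorem testWidth_add_int (n : ℕ) (y : ℝ) (k : ℤ) : testWidth n (y + k) = testWidth n y := by
  have : Function.Periodic (testWidth n) 1 := fun y => by simp [testWidth, mul_add]
  simpa using this.int_mul k y

theorem contDiff_testWidth (n : ℕ) : ContDiff ℝ ∞ (testWidth n) := by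
  unfold testWidth
  fun_prop

theorem exists_two_sub_le_testWidth (n : ℕ) {ε : ℝ} (hε : 0 < ε) :
    ∃ η > 0, ∀ (y : ℝ) (k : ℤ), |y - k| ≤ η → 2 - ε ≤ testWidth n y := by
  have hc : Filter.Tendsto (testWidth n) (nhds 0) (nhds 2) :=
    (contDiff_testWidth n).continuous.tendsto' _ _ (by simp [testWidth]; norm_num)
  obtain ⟨η, hη, h⟩ := Metric.eventually_nhds_iff.1
    (hc.eventually_const_lt (show 2 - ε < 2 by linarith))
  refine ⟨η / 2, half_pos hη, fun y k hy => ?_⟩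
  have := h (y := y - k) (by rw [Real.dist_eq, sub_zero]; linarith)
  rw [← testWidth_add_int n (y - k) k, sub_add_cancel] at this
  exact this.le

/-- Dominated convergence: the cosine has modulus 1 only at the integers, a null set. -/
theorem tendsto_integral_testWidth :
    Filter.Tendsto (fun n => ∫ y in (0 : ℝ)..2, testWidth n y) Filter.atTop (nhds 2) := by
  have h : Filter.Tendsto (fun n : ℕ => ∫ y in (0 : ℝ)..2, testWidth n y) Filter.atTop
      (nhds (∫ y in (0 : ℝ)..2, (1 : ℝ))) := by
    refine intervalIntegral.tendsto_integral_filter_of_dominated_convergence (fun _ => 2)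
      (.of_forall fun n => (contDiff_testWidth n).continuous.aestronglyMeasurable)
      (.of_forall fun n => .of_forall fun y _ => ?_) (by simp) ?_
    · rw [Real.norm_eq_abs, abs_of_nonneg (zero_le_one.trans (one_le_testWidth n y))]
      have := pow_le_one₀ (n := n) (sq_nonneg (Real.cos (Real.pi * y))) (Real.cos_sq_le_one _)
      unfold testWidth
      linarith
    · have hnull : volume (Set.range fun k : ℤ => (k : ℝ)) = 0 :=
        (Set.countable_range _).measure_zero _
      filter_upwards [compl_mem_ae_iff.2 hnull] with y hy _
      have hlt : Real.cos (Real.pi * y) ^ 2 < 1 := by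
        refine lt_of_le_of_ne (Real.cos_sq_le_one _) fun h1 => hy ?_
        have hs : Real.sin (Real.pi * y) = 0 := by
          have := Real.sin_sq_add_cos_sq (Real.pi * y)
          exact pow_eq_zero_iff two_ne_zero |>.1 (by linarith)
        obtain ⟨k, hk⟩ := Real.sin_eq_zero_iff.1 hs
        exact ⟨k, mul_left_cancel₀ Real.pi_ne_zero (by rw [← hk]; ring)⟩
      simpa [testWidth] using
        (tendsto_pow_atTop_nhds_zero_of_lt_one (sq_nonneg _) hlt).const_add 1
  simpa using h

theorem normalForm_im {γ : Equiv.Perm ℂ} (hγ : γ ∈ kleinGroup) :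
    ∃ (s : ℝ) (q : ℤ), (s = 1 ∨ s = -1) ∧ (∀ z, (γ z).im = s * z.im + 2 * q) ∧
      (∀ z w, (γ z - γ w).re = (z - w).re) ∧ ∀ z v, fderiv ℝ γ z v = ⟨v.re, s * v.im⟩ := by
  obtain ⟨p, q, ⟨-, h⟩ | ⟨-, h⟩⟩ := kleinGroup_normalForm hγ
  · refine ⟨1, q, .inl rfl, fun z => by simp [h], fun z w => by simp [h], fun z v => ?_⟩
    have : HasFDerivAt (fun z : ℂ => z + p * Real.pi + 2 * q * I) (ContinuousLinearMap.id ℝ ℂ) z :=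
      ((hasFDerivAt_id z).add_const _).add_const _
    rw [funext h, this.fderiv]
    simp
  · refine ⟨-1, q, .inr rfl, fun z => by simp [h], fun z w => by simp [h], fun z v => ?_⟩
    have : HasFDerivAt (fun z : ℂ => (starRingEnd ℂ) z + p * Real.pi + 2 * q * I)
        (conjCLE : ℂ →L[ℝ] ℂ) z :=
      ((conjCLE : ℂ →L[ℝ] ℂ).hasFDerivAt.add_const _).add_const _
    rw [funext h, this.fderiv]
    apply Complex.ext <;> simp

/-- The square of a linear form, as a symmetric bilinear form. -/
def squareForm (l : ℂ →L[ℝ] ℝ) : ℂ →L[ℝ] ℂ →L[ℝ] ℝ := l.smulRight l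

theorem squareForm_apply (l : ℂ →L[ℝ] ℝ) (v w : ℂ) : squareForm l v w = l v * l w := by
  simp [squareForm]

set_option maxSynthPendingDepth 3 in
/-- The metric `a(y)² dx² + B² dy²`, where `a` is the width function. -/
def testMetric (n : ℕ) (B : ℝ) (hB : 0 < B) : KleinMetric where
  form z := testWidth n z.im ^ 2 • squareForm reCLM + B ^ 2 • squareForm imCLM
  continuous_form := by
    have h := (contDiff_testWidth n).continuous.comp continuous_im
    exact ((h.pow 2).smul (continuous_const (y := squareForm reCLM))).add continuous_const
  symm z v w := by
    simp only [add_apply, smul_apply, squareForm_apply, reCLM_apply, imCLM_apply,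
      smul_eq_mul]
    ring
  pos z v hv := by
    have ha := zero_lt_one.trans_le (one_le_testWidth n z.im)
    simp only [add_apply, smul_apply, squareForm_apply, reCLM_apply, imCLM_apply,
      smul_eq_mul]
    rcases eq_or_ne v.re 0 with h | h
    · have : v.im ≠ 0 := fun h' => hv (Complex.ext h h')
      have := mul_self_pos.2 this
      have := mul_self_nonneg v.re
      positivity
    · have := mul_self_pos.2 h
      have := mul_self_nonneg v.im
      positivity
  invariant γ hγ z v w := by
    obtain ⟨s, q, hs, him, -, hd⟩ := normalForm_im hγ
    have ha : testWidth n (γ z).im = testWidth n z.im := by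
      have := testWidth_add_int n (s * z.im) (2 * q)
      push_cast at this
      rw [him, this]
      rcases hs with rfl | rfl
      · rw [one_mul]
      · rw [neg_one_mul, testWidth_neg]
    simp only [add_apply, smul_apply, squareForm_apply, reCLM_apply, imCLM_apply,
      smul_eq_mul, ha, hd]
    rcases hs with rfl | rfl <;> ring

namespace testMetric

open KleinMetric

variable {n : ℕ} {B : ℝ} {hB : 0 < B}

theorem form_apply (z v w : ℂ) : (testMetric n B hB).form z v w =
    testWidth n z.im ^ 2 * (v.re * w.re) + B ^ 2 * (v.im * w.im) := by
  simp [testMetric, squareForm_apply]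

set_option maxSynthPendingDepth 3 in
theorem isSmooth : (testMetric n B hB).IsSmooth := by
  have := contDiff_testWidth n
  have h : ContDiff ℝ ∞ fun z : ℂ => testWidth n z.im := this.comp imCLM.contDiff
  exact ((h.pow 2).smul (contDiff_const (c := squareForm reCLM))).add contDiff_const

theorem vol_eq : (testMetric n B hB).vol = Real.pi * B * ∫ y in (0 : ℝ)..2, testWidth n y := by
  have h (x y : ℝ) : (testMetric n B hB).density (x + y * I) = B * testWidth n y := by
    rw [density]
    simp only [form_apply, one_re, one_im, I_re, I_im]
    simp only [add_im, ofReal_im, mul_im, ofReal_re, I_re, I_im, mul_zero, mul_one, zero_add,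
      add_zero]
    have := zero_lt_one.trans_le (one_le_testWidth n y)
    rw [show testWidth n y ^ 2 * B ^ 2 - 0 ^ 2 = (B * testWidth n y) ^ 2 by
      ring, Real.sqrt_sq (by positivity)]
  rw [KleinMetric.vol_eq]
  simp only [h, intervalIntegral.integral_const_mul, intervalIntegral.integral_const]
  simp
  ring

theorem mul_abs_re_le_speed (z v : ℂ) :
    testWidth n z.im * |v.re| ≤ (testMetric n B hB).speed z v := by
  have := zero_lt_one.trans_le (one_le_testWidth n z.im)
  refine Real.le_sqrt_of_sq_le ?_
  rw [form_apply, mul_pow, sq_abs]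
  nlinarith [mul_nonneg (sq_nonneg B) (sq_nonneg v.im)]

theorem mul_abs_im_le_speed (z v : ℂ) : B * |v.im| ≤ (testMetric n B hB).speed z v := by
  refine Real.le_sqrt_of_sq_le ?_
  rw [form_apply, mul_pow, sq_abs]
  nlinarith [mul_nonneg (sq_nonneg (testWidth n z.im)) (sq_nonneg v.re)]

theorem mul_abs_sub_re_le {c : ℝ → ℂ} (hc : ContDiff ℝ 1 c) {A : ℝ} (hA : 0 ≤ A)
    (h : ∀ s ∈ Set.Icc (0 : ℝ) 1, A ≤ testWidth n (c s).im) :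
    A * |(c 1 - c 0).re| ≤ (testMetric n B hB).arcLength c 0 1 := by
  have hcd := hc.continuous_deriv le_rfl
  have hre : ∫ s in (0 : ℝ)..1, (deriv c s).re = (c 1 - c 0).re := by
    rw [sub_re]
    refine intervalIntegral.integral_eq_sub_of_hasDerivAt (f := fun s => (c s).re)
      (fun s _ => ?_) (Continuous.intervalIntegrable (by fun_prop) _ _)
    exact reCLM.hasFDerivAt.comp_hasDerivAt s ((hc.differentiable one_ne_zero) s).hasDerivAt
  calc A * |(c 1 - c 0).re| ≤ A * ∫ s in (0 : ℝ)..1, |(deriv c s).re| := by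
        rw [← hre]
        exact mul_le_mul_of_nonneg_left
          (intervalIntegral.abs_integral_le_integral_abs zero_le_one) hA
    _ = ∫ s in (0 : ℝ)..1, A * |(deriv c s).re| := by
        rw [intervalIntegral.integral_const_mul]
    _ ≤ _ := intervalIntegral.integral_mono_on zero_le_one
        (Continuous.intervalIntegrable (by fun_prop) _ _)
        ((continuous_speed_deriv _ hc).intervalIntegrable _ _) fun s hs =>
        (mul_le_mul_of_nonneg_right (h s hs) (abs_nonneg _)).trans (mul_abs_re_le_speed _ _)

theorem isShort_im : (testMetric n B hB).IsShort fun z => B * z.im := by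
  refine ⟨contDiff_const.mul imCLM.contDiff, fun z v => ?_⟩
  have : HasFDerivAt (fun z : ℂ => B * z.im) (B • imCLM) z := imCLM.hasFDerivAt.const_mul B
  rw [this.fderiv, smul_apply, imCLM_apply, smul_eq_mul, abs_mul, abs_of_pos hB]
  exact mul_abs_im_le_speed z v

theorem mul_abs_sub_im_le {c : ℝ → ℂ} (hc : ContDiff ℝ 1 c) {s t : ℝ}
    (hs : s ∈ Set.Icc (0 : ℝ) 1) (ht : t ∈ Set.Icc (0 : ℝ) 1) :
    B * |(c t).im - (c s).im| ≤ (testMetric n B hB).arcLength c 0 1 := by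
  wlog hst : s ≤ t generalizing s t
  · rw [abs_sub_comm]
    exact this ht hs (le_of_not_ge hst)
  have h1 := isShort_im.isRLip.abs_sub_le (g := testMetric n B hB) (c t) (c s)
  rw [← mul_sub, abs_mul, abs_of_pos hB, rdist_comm] at h1
  have h2 := (testMetric n B hB).rdist_le_arcLength hc hst
  have h3 := (testMetric n B hB).arcLength_nonneg c hs.1
  have h4 := (testMetric n B hB).arcLength_nonneg c ht.2
  linarith [(testMetric n B hB).arcLength_add hc 0 s t, (testMetric n B hB).arcLength_add hc 0 t 1]

theorem two_mul_le_lv : 2 * B ≤ (testMetric n B hB).lv := by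
  refine le_csInf ⟨_, ⟨⟨fun s => (s : ℂ) * vert 0, by fun_prop⟩, ?_, rfl⟩⟩ ?_
  · refine mem_freeHomotopyClass vert_mem_kleinGroup ?_ (by simp)
    exact (ofRealCLM.contDiff (n := 1)).mul contDiff_const
  · rintro _ ⟨c, hc, rfl⟩
    obtain ⟨δ, hδ, h⟩ := exists_conj_of_mem_freeHomotopyClass vert_mem_kleinGroup hc
    obtain ⟨s, q, hs, him, -⟩ := normalForm_im hδ
    set w := δ⁻¹ (c 0) with hw
    have h0 : c 0 = δ w := by simp [hw]
    have := mul_abs_sub_im_le (n := n) (hB := hB) hc.1 (s := 0) (t := 1) (by simp) (by simp)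
    have e : |(c 1).im - (c 0).im| = 2 := by
      rw [h, h0, him, him]
      have : s * (vert w).im + 2 * q - (s * w.im + 2 * q) = s * 2 := by simp [vert]; ring
      rw [this]
      rcases hs with rfl | rfl <;> simp
    rw [e] at this
    exact (mul_comm _ _).trans_le this

end testMetric

/-- The powers of a glide reflection of the Klein bottle group. -/
theorem zpow_glide_apply {γ : Equiv.Perm ℂ} {q : ℤ}
    (hγ : ∀ z, γ z = (starRingEnd ℂ) z + Real.pi + 2 * q * I) (m : ℤ) (z : ℂ) :
    (γ ^ (2 * m)) z = z + 2 * m * Real.pi ∧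
      (γ ^ (2 * m + 1)) z = (starRingEnd ℂ) z + (2 * m + 1) * Real.pi + 2 * q * I := by
  have h2 (z) : (γ ^ (2 : ℤ)) z = z + 2 * Real.pi := by
    rw [zpow_two, Equiv.Perm.mul_apply, hγ, hγ]
    simp [map_ofNat]
    ring
  have even (m : ℤ) (z : ℂ) : (γ ^ (2 * m)) z = z + 2 * m * Real.pi := by
    induction m using Int.induction_on generalizing z with
    | zero => simp
    | succ k ih =>
      rw [mul_add, mul_one, zpow_add, Equiv.Perm.mul_apply, h2, ih]
      push_cast
      ring
    | pred k ih =>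
      have hz : z = (γ ^ (2 : ℤ)) (z - 2 * Real.pi) := by rw [h2]; ring
      conv_lhs => rw [hz]
      rw [← Equiv.Perm.mul_apply, ← zpow_add, show 2 * (-(k : ℤ) - 1) + 2 = 2 * -(k : ℤ) by ring, ih]
      push_cast
      ring
  refine ⟨even m z, ?_⟩
  rw [zpow_add, zpow_one, Equiv.Perm.mul_apply, even, hγ]
  ring

namespace testMetric

open KleinMetric

variable {n : ℕ} {B : ℝ} {hB : 0 < B}

/-- Even powers move horizontally by at least 2π, where width 1 suffices. For an odd power the curve
meets the integer height of its axis: either it stays within η, where the width is at least 2 - ε,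
or leaving costs at least Bη ≥ 2π. -/
theorem le_leastLengthPowers {γ : Equiv.Perm ℂ} (hmem : γ ∈ kleinGroup) {q : ℤ}
    (hγ : ∀ z, γ z = (starRingEnd ℂ) z + Real.pi + 2 * q * I) {ε η : ℝ} (hε : 0 < ε) (hε1 : ε < 1)
    (hη : ∀ (y : ℝ) (k : ℤ), |y - k| ≤ η → 2 - ε ≤ testWidth n y) (hBη : 2 * Real.pi ≤ B * η) :
    (2 - ε) * Real.pi ≤ (testMetric n B hB).leastLengthPowers γ := by
  have hπ := Real.pi_pos
  have hγ1 : γ ≠ 1 := fun h => by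
    have := congrArg Complex.re (hγ 0)
    simp [h, hπ.ne] at this
  refine le_csInf ⟨_, ⟨⟨fun s => (s : ℂ) * γ 0, by fun_prop⟩,
    ⟨γ, Subgroup.mem_zpowers γ, hγ1, ?_⟩, rfl⟩⟩ ?_
  · refine mem_freeHomotopyClass hmem ?_ (by simp)
    exact (ofRealCLM.contDiff (n := 1)).mul contDiff_const
  rintro _ ⟨c, ⟨_, ⟨k, rfl⟩, hk1, hc⟩, rfl⟩
  change (2 - ε) * Real.pi ≤ (testMetric n B hB).arcLength c 0 1
  obtain ⟨δ, hδ, h⟩ := exists_conj_of_mem_freeHomotopyClass (zpow_mem hmem k) hc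
  obtain ⟨s, j, hs, him, hre, -⟩ := normalForm_im hδ
  set w := δ⁻¹ (c 0) with hw
  have h0 : c 0 = δ w := by simp [hw]
  simp only at h hk1
  have hwidth {A : ℝ} (hA : 0 ≤ A) (h : ∀ s ∈ Set.Icc (0 : ℝ) 1, A ≤ testWidth n (c s).im) :=
    mul_abs_sub_re_le (n := n) (hB := hB) hc.1 hA h
  obtain ⟨m, rfl | rfl⟩ := Int.even_or_odd' k
  · have hm : m ≠ 0 := by rintro rfl; simp at hk1
    have e : (c 1 - c 0).re = 2 * Real.pi * m := by
      rw [h, h0, hre, (zpow_glide_apply hγ m w).1]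
      simp
      ring
    have h1 := hwidth zero_le_one fun s _ => one_le_testWidth n _
    have h2 : (1 : ℝ) ≤ |(m : ℝ)| := by exact_mod_cast Int.one_le_abs hm
    rw [e, abs_mul, abs_of_pos (by positivity)] at h1
    nlinarith
  · have e : (c 1 - c 0).re = Real.pi * (2 * m + 1 : ℤ) := by
      rw [h, h0, hre, (zpow_glide_apply hγ m w).2]
      simp
      ring
    have h2 : (1 : ℝ) ≤ |((2 * m + 1 : ℤ) : ℝ)| := by
      exact_mod_cast Int.one_le_abs (show 2 * m + 1 ≠ 0 by omega)
    -- The height of the axis. The endpoints lie symmetrically about it, so the curve crosses it.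
    obtain ⟨i, hi⟩ : ∃ i : ℤ, (c 1).im = 2 * i - (c 0).im := by
      have hsum : (c 1).im + (c 0).im = 2 * (s * q + 2 * j) := by
        rw [h, h0, him, him, (zpow_glide_apply hγ m w).2]
        simp
        ring
      rcases hs with rfl | rfl
      · exact ⟨q + 2 * j, by push_cast; linarith⟩
      · exact ⟨-q + 2 * j, by push_cast; linarith⟩
    obtain ⟨s₀, hs₀, hs₀i⟩ : ∃ s₀ ∈ Set.Icc (0 : ℝ) 1, (c s₀).im = i := by
      have hcim : Continuous fun s : ℝ => (c s).im := by fun_prop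
      have := intermediate_value_uIcc (a := 0) (b := 1) hcim.continuousOn
      rw [Set.uIcc_of_le zero_le_one] at this
      refine this ?_
      simp only [Set.mem_uIcc]
      rcases le_total (c 0).im i with h' | h'
      · exact .inl ⟨h', by linarith⟩
      · exact .inr ⟨by linarith, h'⟩
    by_cases hnear : ∀ s ∈ Set.Icc (0 : ℝ) 1, |(c s).im - i| ≤ η
    · have h1 := hwidth (show 0 ≤ 2 - ε by linarith) fun s hs => hη _ i (hnear s hs)
      rw [e, abs_mul, abs_of_pos hπ] at h1
      refine le_trans ?_ h1
      exact mul_le_mul_of_nonneg_left (le_mul_of_one_le_right hπ.le h2) (by linarith)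
    · push Not at hnear
      obtain ⟨t, ht, hlt⟩ := hnear
      have h1 := mul_abs_sub_im_le (n := n) (hB := hB) hc.1 hs₀ ht
      rw [hs₀i] at h1
      have := mul_lt_mul_of_pos_left hlt hB
      nlinarith

end testMetric

theorem exists_testMetric {C : ℝ} (hC : C < 2) : ∃ g : KleinMetric, g.IsSmooth ∧
    C * g.vol < g.Lσ * g.lv ∧ C * g.vol < g.leastLengthPowers (vert * glide) * g.lv := by
  wlog hC1 : 1 ≤ C generalizing C
  · obtain ⟨g, hg, h1, h2⟩ := this one_lt_two le_rfl
    have := mul_le_mul_of_nonneg_right (le_of_not_ge hC1) g.vol_pos.le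
    exact ⟨g, hg, this.trans_lt h1, this.trans_lt h2⟩
  have hπ := Real.pi_pos
  set ε := (2 - C) / 4 with hε
  have hε0 : 0 < ε := by linarith
  have hε1 : ε < 1 := by linarith
  obtain ⟨n, hn⟩ := (tendsto_integral_testWidth.eventually_lt_const
    (show (2 : ℝ) < 2 + ε by linarith)).exists
  obtain ⟨η, hη0, hη⟩ := exists_two_sub_le_testWidth n hε0
  have hB : 0 < 2 * Real.pi / η := by positivity
  -- B is chosen last: the volume and the lower bound for `lv` both scale linearly in B, so its size
  -- does not affect the ratio.
  set B := 2 * Real.pi / η with hBdef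
  have hBη : 2 * Real.pi ≤ B * η := by rw [hBdef, div_mul_cancel₀ _ hη0.ne']
  have hl := testMetric.two_mul_le_lv (n := n) (hB := hB)
  have key {L : ℝ} (hL : (2 - ε) * Real.pi ≤ L) :
      C * (testMetric n B hB).vol < L * (testMetric n B hB).lv := by
    have h1 : (2 - ε) * Real.pi * (2 * B) ≤ L * (testMetric n B hB).lv :=
      mul_le_mul hL hl (by positivity) ((mul_nonneg (by linarith) hπ.le).trans hL)
    refine lt_of_lt_of_le ?_ h1
    rw [testMetric.vol_eq]
    have h2 : C * ∫ y in (0 : ℝ)..2, testWidth n y < (2 - ε) * 2 := by nlinarith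
    have := mul_lt_mul_of_pos_left h2 (mul_pos hπ hB)
    linarith
  refine ⟨testMetric n B hB, testMetric.isSmooth, key ?_, key ?_⟩
  · exact testMetric.le_leastLengthPowers glide_mem_kleinGroup (q := 0) (by simp [glide]) hε0 hε1 hη
      hBη
  · exact testMetric.le_leastLengthPowers (mul_mem vert_mem_kleinGroup glide_mem_kleinGroup) (q := 1)
      (by simp [glide, vert]) hε0 hε1 hη hBη

end

theorem mainTheorem5 :
    (∀ g : KleinMetric, g.Lσ * g.lv ≤ 2 * g.vol) ∧
    (∀ C : ℝ, C < 2 → ∃ g : KleinMetric, g.IsSmooth ∧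
      C * g.vol < g.Lσ * g.lv ∧
      C * g.vol < g.leastLengthPowers (vert * glide) * g.lv) ∧
    (∀ g : KleinMetric, g.Lσ * g.lv ≠ 2 * g.vol) ∧
    IsLUB (conformalConstant '' Set.Ioi 0) 2 :=
  ⟨fun g => g.Lσ_mul_lv_le, fun _ hC => exists_testMetric hC, fun g => g.Lσ_mul_lv_ne,
    isLUB_conformalConstant⟩
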